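/- Let $\mathbb K=\mathbb R$ or $\mathbb C$, let $1\le k<n$, let $\mathbb K\{x\}$ be the ring of convergent power series in $x=(x_1,\dots,x_n)$, and let $\mathbb K\{\tilde x\}\subset\mathbb K\{x\}$ be the ring of convergent power series in $\tilde x=(x_{k+1},\dots,x_n)$. A positive linear form is $L(\beta)=\sum_{i=1}^n\lambda_i\beta_i$ with real $\lambda_i>0$. Given such $L$, order $\mathbb N^n$ totally by the lexicographic order of the tuples $(L(\beta),\beta_n,\dots,\beta_1)$; for $0\ne F=\sum_\beta f_\beta x^\beta\in\mathbb K\{x\}$ let $\exp_L F$ be the least $\beta$ with $f_\beta\ne0$, and for an ideal $I$ of $\mathbb K\{x\}$ let $\mathfrak N_L(I)=\{\exp_L F : F\in I\setminus\{0\}\}\subset\mathbb N^n$ be its diagram of initial exponents. Let $I$ be an ideal in $\mathbb K\{x\}$. (i) If there exist a positive linear form $L$ and a set $D\subset\mathbb N^k$ such that $\mathfrak N_L(I)=D\times\mathbb N^{n-k}$, then $\mathbb K\{x\}/I$ is a flat $\mathbb K\{\tilde x\}$-module. (ii) Conversely, if $\mathbb K\{x\}/I$ is a flat $\mathbb K\{\tilde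 x\}$-module, then there exist an integer $l_0\ge1$ and a set $D\subset\mathbb N^k$ such that, for all real $l\ge l_0$, the diagram with respect to the positive linear form $L(\beta)=\sum_{i=1}^k\beta_i+\sum_{j=k+1}^n l\beta_j$ satisfies $\mathfrak N_L(I)=D\times\mathbb N^{n-k}$. -/

import Mathlib

namespace FlatDiagram

noncomputable section

/-- A formal power series `F = ∑ f_β x^β` in `x = (x_1, …, x_n)` is convergent if
`∑ ‖f_β‖ r^|β| < ∞` for some `r > 0`, i.e. if it converges absolutely on a neighbourhood of `0`. -/
def IsConvergent {K : Type*} [RCLike K] {n : ℕ} (F : MvPowerSeries (Fin n) K) : Prop :=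
  ∃ r : ℝ, 0 < r ∧
    Summable fun β : Fin n →₀ ℕ => ‖MvPowerSeries.coeff β F‖ * r ^ β.degree

theorem IsConvergent.add {K : Type*} [RCLike K] {n : ℕ} {F G : MvPowerSeries (Fin n) K}
    (hF : IsConvergent F) (hG : IsConvergent G) : IsConvergent (F + G) := by
  obtain ⟨r, hr, hF⟩ := hF
  obtain ⟨s, hs, hG⟩ := hG
  have ht : 0 < min r s := lt_min hr hs
  refine ⟨min r s, ht, Summable.of_nonneg_of_le (fun β => by positivity) (fun β => ?_)
    (hF.add hG)⟩
  rw [map_add]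
  calc ‖MvPowerSeries.coeff β F + MvPowerSeries.coeff β G‖ * min r s ^ β.degree
      ≤ (‖MvPowerSeries.coeff β F‖ + ‖MvPowerSeries.coeff β G‖) * min r s ^ β.degree := by
        gcongr; exact norm_add_le _ _
    _ = ‖MvPowerSeries.coeff β F‖ * min r s ^ β.degree
        + ‖MvPowerSeries.coeff β G‖ * min r s ^ β.degree := add_mul _ _ _
    _ ≤ _ := by
        gcongr
        · exact min_le_left _ _
        · exact min_le_right _ _

theorem IsConvergent.mul {K : Type*} [RCLike K] {n : ℕ} {F G : MvPowerSeries (Fin n) K}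
    (hF : IsConvergent F) (hG : IsConvergent G) : IsConvergent (F * G) := by
  obtain ⟨r, hr, hF⟩ := hF
  obtain ⟨s, hs, hG⟩ := hG
  have ht : 0 < min r s := lt_min hr hs
  have hF' : Summable fun β : Fin n →₀ ℕ =>
      ‖MvPowerSeries.coeff β F‖ * min r s ^ β.degree :=
    Summable.of_nonneg_of_le (fun β => by positivity)
      (fun β => by gcongr; exact min_le_left _ _) hF
  have hG' : Summable fun β : Fin n →₀ ℕ =>
      ‖MvPowerSeries.coeff β G‖ * min r s ^ β.degree :=
    Summable.of_nonneg_of_le (fun β => by positivity)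
      (fun β => by gcongr; exact min_le_right _ _) hG
  have key : Summable fun β : Fin n →₀ ℕ => ∑ p ∈ Finset.HasAntidiagonal.antidiagonal β,
      (‖MvPowerSeries.coeff p.1 F‖ * min r s ^ p.1.degree) *
        (‖MvPowerSeries.coeff p.2 G‖ * min r s ^ p.2.degree) :=
    summable_sum_mul_antidiagonal_of_summable_mul
      (f := fun β : Fin n →₀ ℕ => ‖MvPowerSeries.coeff β F‖ * min r s ^ β.degree)
      (g := fun β : Fin n →₀ ℕ => ‖MvPowerSeries.coeff β G‖ * min r s ^ β.degree)
      (hF'.mul_of_nonneg hG' (fun β => by positivity) (fun β => by positivity))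
  have bound : ∀ β : Fin n →₀ ℕ, ‖MvPowerSeries.coeff β (F * G)‖ * min r s ^ β.degree ≤
      ∑ p ∈ Finset.HasAntidiagonal.antidiagonal β, (‖MvPowerSeries.coeff p.1 F‖ * min r s ^ p.1.degree) *
        (‖MvPowerSeries.coeff p.2 G‖ * min r s ^ p.2.degree) := by
    intro β
    have h1 := norm_sum_le (Finset.HasAntidiagonal.antidiagonal β)
      fun p => MvPowerSeries.coeff p.1 F * MvPowerSeries.coeff p.2 G
    rw [← MvPowerSeries.coeff_mul] at h1
    refine (mul_le_mul_of_nonneg_right h1 (pow_nonneg ht.le _)).trans (le_of_eq ?_)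
    rw [Finset.sum_mul]
    refine Finset.sum_congr rfl fun p hp => ?_
    have hd : β.degree = p.1.degree + p.2.degree := by
      rw [← Finset.HasAntidiagonal.mem_antidiagonal.mp hp, map_add]
    rw [hd, pow_add, norm_mul]
    ring
  exact ⟨min r s, ht, Summable.of_nonneg_of_le
    (fun β => mul_nonneg (norm_nonneg _) (pow_nonneg ht.le _)) bound key⟩

theorem isConvergent_C {K : Type*} [RCLike K] {n : ℕ} (a : K) :
    IsConvergent (MvPowerSeries.C a : MvPowerSeries (Fin n) K) := by
  classical
  refine ⟨1, one_pos, summable_of_ne_finset_zero (s := {0}) fun β hβ => ?_⟩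
  rw [MvPowerSeries.coeff_C, if_neg (by simpa using hβ)]
  simp

/-- The ring `K{x}` of convergent power series in `x = (x_1, …, x_n)`; the variables are indexed
by `Fin n`, so that `x_i` in the usual numbering is the variable with index `i - 1`. -/
def convergentSeries (K : Type*) [RCLike K] (n : ℕ) :
    Subalgebra K (MvPowerSeries (Fin n) K) where
  carrier := {F | IsConvergent F}
  mul_mem' := IsConvergent.mul
  add_mem' := IsConvergent.add
  algebraMap_mem' a := isConvergent_C a

/-- The position among `x_1, …, x_n` of the variables of `x̃ = (x_{k+1}, …, x_n)`. -/
def tailIndex (n k : ℕ) (j : Fin (n - k)) : Fin n := ⟨k + j, by omega⟩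

theorem tailIndex_injective (n k : ℕ) : Function.Injective (tailIndex n k) := by
  intro i j h
  have := congrArg Fin.val h
  simp only [tailIndex] at this
  exact Fin.ext (by omega)

theorem IsConvergent.rename_tailIndex {K : Type*} [RCLike K] {n k : ℕ}
    {F : MvPowerSeries (Fin (n - k)) K} (hF : IsConvergent F) :
    IsConvergent (MvPowerSeries.rename (tailIndex n k) F) := by
  obtain ⟨r, hr, hF⟩ := hF
  have hinj := Finsupp.mapDomain_injective (M := ℕ) (tailIndex_injective n k)
  refine ⟨r, hr, (hinj.summable_iff fun β hβ => ?_).mp (hF.congr fun β => ?_)⟩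
  · rw [MvPowerSeries.coeff_rename_eq_zero _ _ hβ]
    simp
  · have h := MvPowerSeries.coeff_embDomain_rename ⟨tailIndex n k, tailIndex_injective n k⟩ F β
    rw [Finsupp.embDomain_eq_mapDomain] at h
    simp only [Function.Embedding.coeFn_mk] at h
    simp only [Function.comp_apply]
    rw [h, Finsupp.degree_mapDomain]

/-- The inclusion `K{x̃} → K{x}`, for `x̃ = (x_{k+1}, …, x_n)`. -/
def tailInclusion (K : Type*) [RCLike K] (n k : ℕ) :
    convergentSeries K (n - k) →ₐ[K] convergentSeries K n :=
  ((MvPowerSeries.rename (tailIndex n k)).comp (convergentSeries K (n - k)).val).codRestrict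
    (convergentSeries K n) fun F => IsConvergent.rename_tailIndex F.2

/-- `K{x}/I` is a flat `K{x̃}`-module, for `x̃ = (x_{k+1}, …, x_n)`. -/
def IsFlatOverTail {K : Type*} [RCLike K] {n : ℕ} (k : ℕ)
    (I : Ideal (convergentSeries K n)) : Prop :=
  RingHom.Flat (R := convergentSeries K (n - k)) (S := convergentSeries K n ⧸ I)
    ((Ideal.Quotient.mk I).comp (tailInclusion K n k).toRingHom)

/-- The linear form `L(β) = ∑ λ_i β_i` with coefficients `λ`, evaluated on exponents. -/
def linForm {n : ℕ} (lam : Fin n → ℝ) (β : Fin n →₀ ℕ) : ℝ := ∑ i, lam i * (β i : ℝ)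

/-- The strict order on exponents given by the lexicographic order of the tuples
`(L(β), β_n, …, β_1)`. -/
def expLT {n : ℕ} (lam : Fin n → ℝ) (β γ : Fin n →₀ ℕ) : Prop :=
  linForm lam β < linForm lam γ ∨
    (linForm lam β = linForm lam γ ∧ ∃ j, β j < γ j ∧ ∀ i, j < i → β i = γ i)

/-- `β` is the initial exponent of `F`: the least element of its support. -/
def IsInitialExponent {K : Type*} [RCLike K] {n : ℕ} (lam : Fin n → ℝ)
    (F : MvPowerSeries (Fin n) K) (β : Fin n →₀ ℕ) : Prop :=
  MvPowerSeries.coeff β F ≠ 0 ∧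
    ∀ γ, MvPowerSeries.coeff γ F ≠ 0 → γ = β ∨ expLT lam β γ

/-- The diagram of initial exponents of `I` relative to the linear form `L`. -/
def diagram {K : Type*} [RCLike K] {n : ℕ} (lam : Fin n → ℝ)
    (I : Ideal (convergentSeries K n)) : Set (Fin n →₀ ℕ) :=
  {β | ∃ F ∈ I, F ≠ 0 ∧ IsInitialExponent lam (F : MvPowerSeries (Fin n) K) β}

/-- The set `D × ℕ^(n-k)` in `ℕ^n`, for `D` in `ℕ^k`: the exponents whose first `k` entries form
an element of `D`. -/
def cylinder {n k : ℕ} (h : k ≤ n) (D : Set (Fin k →₀ ℕ)) : Set (Fin n →₀ ℕ) :=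
  {β | β.comapDomain (Fin.castLE h) (Fin.castLE_injective h).injOn ∈ D}

end

end FlatDiagram

/-!
Write `y` for the variables `x_1, …, x_k` (the head) and `x̃` for the others (the tail).

The analytic ingredient is the division theorem of Grauert and Hironaka, `exists_division`: modulo
finitely many convergent series, each convergent series has a remainder without exponents in the
set generated by their initial exponents. The order on exponents is first replaced by the values
of a perturbed linear form `L`, for which each initial exponent is the unique minimum
(`exists_linForm_of_expLT`). Rewriting initial terms is then the operator `1 - S` on series, with
`S` strictly increasing `L`, and of norm at most `1 / 2` for the `ℓ¹` norm with weights
`t ^ L β`, if `t` is small. The triangular system `h - S h = G` is solved by recursion, and the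
norm bound shows that the solution converges (`exists_solution_of_triangular`). Division yields
normal forms modulo `I` supported outside the diagram, and also that `K{x}` is Noetherian and local.

If the diagram is `D × ℕ^(n-k)`, multiplication by elements of `K{x̃}` preserves the support
condition for normal forms, so a relation `∑ f_i r_i ∈ I` between normal forms with `f_i ∈ K{x̃}` is
an equality `∑ f_i r_i = 0`. It then holds for the coefficients of each `y^β` separately, so `r`
lies in the closure of the submodule of `K{x}^m` generated by the relations over `K{x̃}` between the
`f_i`. By Krull's intersection theorem this submodule is closed (`mem_of_forall_slice_mem`). Hence
each relation is trivial, which is the equational criterion for flatness.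

Conversely, let `D` be the diagram of the ideal of all `F(y, 0)`, `F ∈ I`, and choose finitely many
`F_i ∈ I` such that the initial exponents of `F_i(y, 0)` generate `D`. If `l` exceeds the degrees
of these exponents, then they are also the initial exponents of the `F_i`. So the cylinder over `D`
is contained in the diagram. An element of `I` with initial exponent outside the cylinder would
have a nonzero remainder in `I` on division by the `F_i`, supported outside the cylinder. This is
impossible (`eq_zero_of_support_of_isFlatOverTail`): by flatness, if `p` is the least degree in `x̃`
of its terms, then it is a combination of monomials of degree `p` in `x̃` with coefficients in `I`,
so that its coefficient at such a monomial, a series in `y`, is of the form `F(y, 0)` with `F ∈ I`.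
The support of this series is disjoint from `D`, so it vanishes.
-/

namespace FlatDiagram

open Filter Topology MvPowerSeries

/-! ### Linear forms and the order on exponents -/

section Exponents

variable {n : ℕ} {lam : Fin n → ℝ} {α β γ δ : Fin n →₀ ℕ}

theorem linForm_add (lam : Fin n → ℝ) (β γ : Fin n →₀ ℕ) :
    linForm lam (β + γ) = linForm lam β + linForm lam γ := by
  simp [linForm, mul_add, Finset.sum_add_distrib]

theorem mul_le_linForm (hlam : ∀ i, 0 < lam i) (β : Fin n →₀ ℕ) (i : Fin n) :
    lam i * β i ≤ linForm lam β :=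
  Finset.single_le_sum (f := fun i => lam i * (β i : ℝ))
    (fun i _ => mul_nonneg (hlam i).le (Nat.cast_nonneg _)) (Finset.mem_univ i)

theorem cast_degree (β : Fin n →₀ ℕ) : (β.degree : ℝ) = ∑ i, (β i : ℝ) := by
  rw [Finsupp.degree_eq_sum, Nat.cast_sum]

theorem mul_degree_le_linForm {m : ℝ} (hm : ∀ i, m ≤ lam i) (β : Fin n →₀ ℕ) :
    m * β.degree ≤ linForm lam β := by
  rw [cast_degree, Finset.mul_sum]
  exact Finset.sum_le_sum fun i _ => mul_le_mul_of_nonneg_right (hm i) (Nat.cast_nonneg _)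

theorem linForm_le_mul_degree {m : ℝ} (hm : ∀ i, lam i ≤ m) (β : Fin n →₀ ℕ) :
    linForm lam β ≤ m * β.degree := by
  rw [cast_degree, Finset.mul_sum]
  exact Finset.sum_le_sum fun i _ => mul_le_mul_of_nonneg_right (hm i) (Nat.cast_nonneg _)

theorem exists_pos_le_of_pos (hlam : ∀ i, 0 < lam i) : ∃ m : ℝ, 0 < m ∧ ∀ i, m ≤ lam i := by
  obtain ⟨m, hm⟩ := (Set.finite_range fun i => (lam i)⁻¹).bddAbove
  refine ⟨(max m 1)⁻¹, by positivity, fun i => ?_⟩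
  rw [inv_le_comm₀ (by positivity) (hlam i)]
  exact (hm ⟨i, rfl⟩).trans (le_max_left _ _)

theorem exists_le_const (lam : Fin n → ℝ) : ∃ m : ℝ, ∀ i, lam i ≤ m := by
  obtain ⟨m, hm⟩ := (Set.finite_range lam).bddAbove
  exact ⟨m, fun i => hm ⟨i, rfl⟩⟩

theorem finite_linForm_le (hlam : ∀ i, 0 < lam i) (c : ℝ) : {β | linForm lam β ≤ c}.Finite := by
  refine (Set.finite_Icc (0 : Fin n →₀ ℕ)
    (Finsupp.equivFunOnFinite.symm fun i => ⌊c / lam i⌋₊)).subset fun β hβ => ⟨zero_le, ?_⟩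
  intro i
  simp only [Finsupp.equivFunOnFinite_symm_apply_apply]
  refine Nat.le_floor ?_
  rw [le_div_iff₀ (hlam i), mul_comm]
  exact (mul_le_linForm hlam β i).trans hβ

theorem expLT_irrefl (β : Fin n →₀ ℕ) : ¬ expLT lam β β := by
  rintro (h | ⟨-, j, hj, -⟩)
  · exact lt_irrefl _ h
  · exact lt_irrefl _ hj

theorem expLT.trans (h₁ : expLT lam α β) (h₂ : expLT lam β γ) : expLT lam α γ := by
  rcases h₁ with h₁ | ⟨h₁, i, hi, hi'⟩
  · rcases h₂ with h₂ | ⟨h₂, -⟩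
    · exact Or.inl (h₁.trans h₂)
    · exact Or.inl (h₁.trans_eq h₂)
  · rcases h₂ with h₂ | ⟨h₂, j, hj, hj'⟩
    · exact Or.inl (h₁.trans_lt h₂)
    · refine Or.inr ⟨h₁.trans h₂, ?_⟩
      rcases lt_trichotomy i j with hij | rfl | hij
      · exact ⟨j, by rwa [hi' j hij], fun l hl => (hi' l (hij.trans hl)).trans (hj' l hl)⟩
      · exact ⟨i, hi.trans hj, fun l hl => (hi' l hl).trans (hj' l hl)⟩
      · exact ⟨i, by rwa [← hj' i hij], fun l hl => (hi' l hl).trans (hj' l (hij.trans hl))⟩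

theorem expLT_trichotomous (lam : Fin n → ℝ) (β γ : Fin n →₀ ℕ) :
    expLT lam β γ ∨ β = γ ∨ expLT lam γ β := by
  rcases lt_trichotomy (linForm lam β) (linForm lam γ) with h | h | h
  · exact Or.inl (Or.inl h)
  · by_cases hβγ : β = γ
    · exact Or.inr (Or.inl hβγ)
    · have hne : (Finset.univ.filter fun i => β i ≠ γ i).Nonempty := by
        by_contra hcon
        rw [Finset.not_nonempty_iff_eq_empty, Finset.filter_eq_empty_iff] at hcon
        exact hβγ (Finsupp.ext fun i => not_not.mp (hcon (Finset.mem_univ i)))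
      obtain ⟨j, hj, hmax⟩ := Finset.exists_max_image _ id hne
      have hj' := (Finset.mem_filter.mp hj).2
      have habove : ∀ i, j < i → β i = γ i := fun i hi => by
        by_contra hcon
        exact (hmax i (Finset.mem_filter.mpr ⟨Finset.mem_univ i, hcon⟩)).not_gt hi
      rcases lt_or_gt_of_ne hj' with hlt | hlt
      · exact Or.inl (Or.inr ⟨h, j, hlt, habove⟩)
      · exact Or.inr (Or.inr (Or.inr ⟨h.symm, j, hlt, fun i hi => (habove i hi).symm⟩))
  · exact Or.inr (Or.inr (Or.inl h))

theorem expLT.add_left (h : expLT lam β γ) (δ : Fin n →₀ ℕ) : expLT lam (δ + β) (δ + γ) := by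
  rcases h with h | ⟨h, j, hj, hj'⟩
  · left
    rw [linForm_add, linForm_add]
    linarith
  · refine Or.inr ⟨by rw [linForm_add, linForm_add, h], j, ?_, fun i hi => ?_⟩
    · simpa using hj
    · simpa using hj' i hi

theorem expLT_of_le_of_ne (hlam : ∀ i, 0 < lam i) (h : β ≤ γ) (hne : β ≠ γ) :
    expLT lam β γ := by
  obtain ⟨δ, rfl⟩ := exists_add_of_le h
  have hδ : δ ≠ 0 := by rintro rfl; simp at hne
  obtain ⟨i, hi⟩ := Finsupp.ne_iff.mp hδ
  left
  rw [linForm_add]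
  have h1 := mul_le_linForm hlam δ i
  have h2 : 0 < lam i * δ i := mul_pos (hlam i) (by exact_mod_cast Nat.pos_of_ne_zero hi)
  linarith

theorem exists_expLT_least (hlam : ∀ i, 0 < lam i) {S : Set (Fin n →₀ ℕ)} (hS : S.Nonempty) :
    ∃ β ∈ S, ∀ γ ∈ S, γ = β ∨ expLT lam β γ := by
  obtain ⟨β₀, hβ₀⟩ := hS
  set T : Set (Fin n →₀ ℕ) := {β | β ∈ S ∧ linForm lam β ≤ linForm lam β₀}
  have hT : T.Finite := (finite_linForm_le hlam (linForm lam β₀)).subset fun β hβ => hβ.2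
  have : IsStrictOrder (Fin n →₀ ℕ) (expLT lam) :=
    { irrefl := expLT_irrefl, trans := fun _ _ _ => expLT.trans }
  obtain ⟨⟨β, hβ⟩, -, hmin⟩ := WellFounded.has_min (hT.wellFoundedOn (r := expLT lam))
    Set.univ ⟨⟨β₀, hβ₀, le_rfl⟩, trivial⟩
  refine ⟨β, hβ.1, fun γ hγ => ?_⟩
  by_cases hγT : linForm lam γ ≤ linForm lam β₀
  · rcases expLT_trichotomous lam β γ with h | h | h
    · exact Or.inr h
    · exact Or.inl h.symm
    · exact absurd h (hmin ⟨γ, hγ, hγT⟩ trivial)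
  · exact Or.inr (Or.inl (hβ.2.trans_lt (not_le.mp hγT)))

/-- The order with respect to a positive linear form is, near finitely many given exponents,
realized by the values of another positive linear form alone: a small perturbation of `lam` by a
linear form with rapidly increasing coefficients resolves the ties. -/
theorem exists_linForm_of_expLT (hlam : ∀ i, 0 < lam i) {ι : Type*} [Finite ι]
    (a : ι → Fin n →₀ ℕ) :
    ∃ mu : Fin n → ℝ, (∀ i, 0 < mu i) ∧
      ∀ j β, expLT lam (a j) β → linForm mu (a j) < linForm mu β := by
  -- `N` exceeds all entries of the given exponents, so that `∑ N ^ i * β i` is compatible with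
  -- the lexicographic comparison from above.
  obtain ⟨N, hN⟩ : ∃ N : ℕ, ∀ j i, a j i < N := by
    obtain ⟨N, hN⟩ := (Set.finite_range fun p : ι × Fin n => a p.1 p.2).bddAbove
    exact ⟨N + 1, fun j i => Nat.lt_succ_of_le (hN ⟨(j, i), rfl⟩)⟩
  set M : Fin n → ℝ := fun i => (N : ℝ) ^ (i : ℕ) with hM
  have hM0 : ∀ β : Fin n →₀ ℕ, 0 ≤ linForm M β := fun β =>
    Finset.sum_nonneg fun i _ => by positivity
  have hlex : ∀ j β, (∃ i, a j i < β i ∧ ∀ i', i < i' → a j i' = β i') →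
      linForm M (a j) < linForm M β := by
    rintro j β ⟨i, hi, hi'⟩
    have hN1 : 1 ≤ N := (Nat.zero_le _).trans_lt (hN j i)
    have hgeom : ∑ i' ∈ Finset.univ.filter (· < i), M i' * (a j i' : ℝ) < M i := by
      have h1 : ∑ i' ∈ Finset.univ.filter (· < i), M i' * (a j i' : ℝ) ≤
          ∑ i' ∈ Finset.univ.filter (· < i), ((N : ℝ) - 1) * (N : ℝ) ^ (i' : ℕ) := by
        refine Finset.sum_le_sum fun i' _ => ?_
        rw [mul_comm]
        refine mul_le_mul_of_nonneg_right ?_ (by positivity)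
        have : a j i' + 1 ≤ N := hN j i'
        have : ((a j i' + 1 : ℕ) : ℝ) ≤ N := by exact_mod_cast this
        push_cast at this
        linarith
      have h2 : ∑ i' ∈ Finset.univ.filter (· < i), ((N : ℝ) - 1) * (N : ℝ) ^ (i' : ℕ) =
          ∑ l ∈ Finset.range i, ((N : ℝ) - 1) * (N : ℝ) ^ l := by
        refine Finset.sum_bij (fun i' _ => (i' : ℕ)) ?_ ?_ ?_ ?_
        · intro i' h; simpa using h
        · intro _ _ _ _ h; exact Fin.ext h
        · intro l hl
          have hl' := Finset.mem_range.mp hl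
          exact ⟨⟨l, hl'.trans i.2⟩, Finset.mem_filter.mpr ⟨Finset.mem_univ _, hl'⟩, rfl⟩
        · intros; rfl
      rw [h2, ← Finset.mul_sum, mul_geom_sum] at h1
      simp only [hM]
      linarith
    have hsplit : ∀ δ : Fin n →₀ ℕ, linForm M δ =
        ∑ i' ∈ Finset.univ.filter (· < i), M i' * (δ i' : ℝ) + M i * δ i +
          ∑ i' ∈ Finset.univ.filter (i < ·), M i' * (δ i' : ℝ) := by
      intro δ
      have h3 : (Finset.univ.filter fun x : Fin n => ¬ x < i) =
          insert i (Finset.univ.filter (i < ·)) := by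
        ext x
        simp only [Finset.mem_filter, Finset.mem_univ, true_and, Finset.mem_insert, not_lt]
        rw [le_iff_eq_or_lt, eq_comm]
      rw [linForm, ← Finset.sum_filter_add_sum_filter_not Finset.univ (· < i), h3,
        Finset.sum_insert (by simp), add_assoc]
    rw [hsplit, hsplit]
    have h4 : ∑ i' ∈ Finset.univ.filter (i < ·), M i' * (a j i' : ℝ) =
        ∑ i' ∈ Finset.univ.filter (i < ·), M i' * (β i' : ℝ) :=
      Finset.sum_congr rfl fun i' h => by rw [hi' i' (Finset.mem_filter.mp h).2]
    have h5 : 0 ≤ ∑ i' ∈ Finset.univ.filter (· < i), M i' * (β i' : ℝ) :=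
      Finset.sum_nonneg fun i' _ => by positivity
    have h6 : M i * (a j i : ℝ) + M i ≤ M i * β i := by
      have : ((a j i + 1 : ℕ) : ℝ) ≤ β i := by exact_mod_cast hi
      push_cast at this
      have h7 : 0 ≤ M i := by positivity
      nlinarith
    linarith
  -- For each `j` only the finitely many `β` with `L β ≤ L (a j) + 1` bound the perturbation.
  have hsmall : ∀ᶠ e : ℝ in 𝓝[>] 0, 0 < e ∧ ∀ j, e * linForm M (a j) < 1 ∧
      ∀ β ∈ {β | linForm lam β ≤ linForm lam (a j) + 1},
        linForm lam (a j) < linForm lam β →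
          e * linForm M (a j) < linForm lam β - linForm lam (a j) := by
    have hlim : ∀ j, Tendsto (fun e : ℝ => e * linForm M (a j)) (𝓝[>] 0) (𝓝 0) := fun j => by
      have : Tendsto (fun e : ℝ => e * linForm M (a j)) (𝓝 0) (𝓝 (0 * linForm M (a j))) :=
        (continuous_id.mul continuous_const).tendsto 0
      rw [zero_mul] at this
      exact this.mono_left nhdsWithin_le_nhds
    refine eventually_mem_nhdsWithin.and (eventually_all.mpr fun j =>
      ((hlim j).eventually_lt_const one_pos).and ?_)
    rw [eventually_all_finite (finite_linForm_le hlam _)]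
    intro β _
    by_cases h : linForm lam (a j) < linForm lam β
    · filter_upwards [(hlim j).eventually_lt_const (sub_pos.mpr h)] with e he _ using he
    · exact Eventually.of_forall fun e h' => absurd h' h
  obtain ⟨e, he, hsm⟩ := hsmall.exists
  have hmu : ∀ β, linForm (fun i => lam i + e * M i) β = linForm lam β + e * linForm M β := by
    intro β
    simp only [linForm, add_mul, Finset.sum_add_distrib, Finset.mul_sum, mul_assoc]
  refine ⟨fun i => lam i + e * M i, fun i => ?_, fun j β h => ?_⟩
  · have : 0 ≤ M i := by positivity
    have := hlam i
    positivity
  · rw [hmu, hmu]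
    have h0 := mul_nonneg he.le (hM0 β)
    rcases h with h | ⟨h, h'⟩
    · by_cases hβ : linForm lam β ≤ linForm lam (a j) + 1
      · have := (hsm j).2 β hβ h
        linarith
      · have := (hsm j).1
        linarith
    · have := mul_lt_mul_of_pos_left (hlex j β h') he
      linarith

theorem exists_isInitialExponent {K : Type*} [RCLike K] (hlam : ∀ i, 0 < lam i)
    {F : MvPowerSeries (Fin n) K} (hF : F ≠ 0) : ∃ β, IsInitialExponent lam F β := by
  obtain ⟨β, hβ⟩ : ∃ β, coeff β F ≠ 0 := by
    by_contra! h
    exact hF (MvPowerSeries.ext fun β => by simpa using h β)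
  exact exists_expLT_least hlam (S := {β | coeff β F ≠ 0}) ⟨β, hβ⟩

theorem IsInitialExponent.monomial_mul {K : Type*} [RCLike K]
    {F : MvPowerSeries (Fin n) K} (hF : IsInitialExponent lam F β) (δ : Fin n →₀ ℕ) :
    IsInitialExponent lam (monomial δ 1 * F) (δ + β) := by
  refine ⟨by simpa [coeff_add_monomial_mul] using hF.1, fun γ hγ => ?_⟩
  rw [coeff_monomial_mul] at hγ
  split_ifs at hγ with h
  · obtain ⟨ε, rfl⟩ := exists_add_of_le h
    rw [add_tsub_cancel_left, one_mul] at hγ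
    rcases hF.2 ε hγ with rfl | h'
    · exact Or.inl rfl
    · exact Or.inr (h'.add_left δ)
  · exact absurd rfl hγ

end Exponents

/-- Dickson's lemma: finitely many elements of `S` lie below all the others. -/
theorem exists_finite_generators {n : ℕ} {S : Set (Fin n →₀ ℕ)} :
    ∃ T : Set (Fin n →₀ ℕ), T ⊆ S ∧ T.Finite ∧ ∀ β ∈ S, ∃ α ∈ T, α ≤ β := by
  refine ⟨{α | Minimal (· ∈ S) α}, fun α h => h.prop,
    WellQuasiOrderedLE.finite_of_isAntichain (setOfPred_minimal_antichain _), fun β hβ => ?_⟩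
  obtain ⟨α, hα, hmin⟩ := exists_minimal_le_of_wellFoundedLT (· ∈ S) β hβ
  exact ⟨α, hmin, hα⟩

/-! ### Convergence in terms of weighted norms -/

section Convergence

variable {K : Type*} [RCLike K] {n : ℕ} {lam : Fin n → ℝ}

theorem IsConvergent.eventually_summable {F : MvPowerSeries (Fin n) K} (hF : IsConvergent F)
    (hlam : ∀ i, 0 < lam i) :
    ∀ᶠ t : ℝ in 𝓝[>] 0, Summable fun β => ‖coeff β F‖ * t ^ linForm lam β := by
  obtain ⟨r, hr, hF⟩ := hF
  obtain ⟨m, hm, hmlam⟩ := exists_pos_le_of_pos hlam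
  have h1 : ∀ᶠ t : ℝ in 𝓝[>] 0, t < min 1 (r ^ m⁻¹) :=
    (eventually_lt_nhds (lt_min one_pos (Real.rpow_pos_of_pos hr _))).filter_mono
      nhdsWithin_le_nhds
  filter_upwards [h1, eventually_mem_nhdsWithin] with t ht ht0
  have ht0 : 0 < t := ht0
  have htr : t ^ m ≤ r := by
    calc t ^ m ≤ (r ^ m⁻¹) ^ m :=
          Real.rpow_le_rpow ht0.le (ht.le.trans (min_le_right _ _)) hm.le
      _ = r := Real.rpow_inv_rpow hr.le hm.ne'
  refine Summable.of_nonneg_of_le (fun β => by positivity) (fun β => ?_) hF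
  refine mul_le_mul_of_nonneg_left ?_ (norm_nonneg _)
  calc t ^ linForm lam β ≤ t ^ (m * β.degree) :=
        Real.rpow_le_rpow_of_exponent_ge ht0 (ht.le.trans (min_le_left _ _))
          (mul_degree_le_linForm hmlam β)
    _ = (t ^ m) ^ β.degree := by rw [Real.rpow_mul ht0.le, Real.rpow_natCast]
    _ ≤ r ^ β.degree := pow_le_pow_left₀ (by positivity) htr _

theorem isConvergent_of_summable {F : MvPowerSeries (Fin n) K} {t : ℝ} (ht : 0 < t)
    (ht1 : t ≤ 1) (hF : Summable fun β => ‖coeff β F‖ * t ^ linForm lam β) :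
    IsConvergent F := by
  obtain ⟨m, hm⟩ := exists_le_const lam
  refine ⟨t ^ m, Real.rpow_pos_of_pos ht _,
    Summable.of_nonneg_of_le (fun β => by positivity) (fun β => ?_) hF⟩
  refine mul_le_mul_of_nonneg_left ?_ (norm_nonneg _)
  rw [← Real.rpow_natCast, ← Real.rpow_mul ht.le]
  exact Real.rpow_le_rpow_of_exponent_ge ht ht1 (linForm_le_mul_degree hm β)

/-- A coefficient whose exponent is strictly least for `L` dominates the rest of the series in the
norm with weights `t ^ L β`, once `t` is small. -/
theorem IsConvergent.eventually_tsum_le {F : MvPowerSeries (Fin n) K} (hF : IsConvergent F)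
    (hlam : ∀ i, 0 < lam i) {c : ℝ} (hF0 : ∀ β, coeff β F ≠ 0 → c < linForm lam β) {ε : ℝ}
    (hε : 0 < ε) :
    ∀ᶠ t : ℝ in 𝓝[>] 0, (Summable fun β => ‖coeff β F‖ * t ^ linForm lam β) ∧
      ∑' β, ‖coeff β F‖ * t ^ linForm lam β ≤ ε * t ^ c := by
  obtain ⟨δ, hδ, hgap⟩ : ∃ δ > 0, ∀ β, coeff β F ≠ 0 → c + δ ≤ linForm lam β := by
    have hev : ∀ᶠ δ : ℝ in 𝓝[>] 0, 0 < δ ∧ δ < 1 ∧ ∀ β ∈ {β | linForm lam β ≤ c + 1},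
        c < linForm lam β → δ < linForm lam β - c := by
      refine eventually_mem_nhdsWithin.and
        (((eventually_lt_nhds one_pos).filter_mono nhdsWithin_le_nhds).and ?_)
      rw [eventually_all_finite (finite_linForm_le hlam _)]
      intro β _
      by_cases h : c < linForm lam β
      · filter_upwards [(eventually_lt_nhds (sub_pos.mpr h)).filter_mono nhdsWithin_le_nhds]
          with e he _ using he
      · exact Eventually.of_forall fun e h' => absurd h' h
    obtain ⟨δ, hδ, hδ1, hδ'⟩ := hev.exists
    refine ⟨δ, hδ, fun β hβ => ?_⟩
    by_cases h : linForm lam β ≤ c + 1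
    · have := hδ' β h (hF0 β hβ)
      linarith
    · linarith
  obtain ⟨s, hs, hs0⟩ := ((hF.eventually_summable hlam).and eventually_mem_nhdsWithin).exists
  have hs0 : 0 < s := hs0
  set C := ∑' β, ‖coeff β F‖ * s ^ linForm lam β with hC
  have hlim : Tendsto (fun t : ℝ => C * s ^ (-(c + δ)) * t ^ δ) (𝓝[>] 0) (𝓝 0) := by
    have h1 : Tendsto (fun t : ℝ => t ^ δ) (𝓝 0) (𝓝 0) := by
      simpa [Real.zero_rpow hδ.ne'] using (Real.continuous_rpow_const hδ.le).tendsto 0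
    simpa using (h1.const_mul (C * s ^ (-(c + δ)))).mono_left nhdsWithin_le_nhds
  filter_upwards [hF.eventually_summable hlam, eventually_mem_nhdsWithin,
    (eventually_lt_nhds hs0).filter_mono nhdsWithin_le_nhds, hlim.eventually_lt_const hε]
    with t hsum ht0 hts htε
  have ht0 : 0 < t := ht0
  refine ⟨hsum, ?_⟩
  have hterm : ∀ β, ‖coeff β F‖ * t ^ linForm lam β ≤
      ‖coeff β F‖ * s ^ linForm lam β * (t / s) ^ (c + δ) := by
    intro β
    by_cases hβ : coeff β F = 0
    · simp [hβ]
    · rw [mul_assoc]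
      refine mul_le_mul_of_nonneg_left ?_ (norm_nonneg _)
      calc t ^ linForm lam β = (s * (t / s)) ^ linForm lam β := by
            rw [mul_div_cancel₀ _ hs0.ne']
        _ = s ^ linForm lam β * (t / s) ^ linForm lam β :=
            Real.mul_rpow hs0.le (by positivity)
        _ ≤ _ := by
            refine mul_le_mul_of_nonneg_left ?_ (by positivity)
            exact Real.rpow_le_rpow_of_exponent_ge (by positivity)
              ((div_le_one hs0).mpr hts.le) (hgap β hβ)
  calc ∑' β, ‖coeff β F‖ * t ^ linForm lam β
      ≤ ∑' β, ‖coeff β F‖ * s ^ linForm lam β * (t / s) ^ (c + δ) :=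
        hsum.tsum_le_tsum hterm (hs.mul_right _)
    _ = C * (t / s) ^ (c + δ) := by rw [tsum_mul_right]
    _ = (C * s ^ (-(c + δ)) * t ^ δ) * t ^ c := by
        rw [Real.div_rpow ht0.le hs0.le, Real.rpow_neg hs0.le, Real.rpow_add ht0]
        ring
    _ ≤ ε * t ^ c := by gcongr

end Convergence

/-! ### Triangular systems -/

/-- An infinite linear system `h = g + S h` has a solution if `(S h) γ` is the sum of the
`h β * s β γ` with `w β < w γ`, for a weight `w` with finite sublevel sets. If `s` defines an
operator of norm at most `1 / 2` on the `ℓ¹` space with weights `r`, then the solution lies in this space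
with `g`. It is supported in each set that contains the support of `g` and, with an index `β`, all
`γ` with `s β γ ≠ 0`. -/
theorem exists_solution_of_triangular {K : Type*} [RCLike K] {ι : Type*} (w r : ι → ℝ)
    (hw : ∀ c, {β | w β < c}.Finite) (hr : ∀ β, 0 ≤ r β) (s : ι → ι → K)
    (hnorm : ∀ β (T : Finset ι), ∑ γ ∈ T, ‖s β γ‖ * r γ ≤ 1 / 2 * r β)
    (g : ι → K) (hg : Summable fun β => ‖g β‖ * r β) :
    ∃ h : ι → K, (∀ γ, h γ = g γ + ∑ β ∈ (hw (w γ)).toFinset, h β * s β γ) ∧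
      (Summable fun β => ‖h β‖ * r β) ∧
      ∀ U : Set ι, (∀ β, g β ≠ 0 → β ∈ U) → (∀ β ∈ U, ∀ γ, s β γ ≠ 0 → γ ∈ U) →
        ∀ β, h β ≠ 0 → β ∈ U := by
  classical
  have hwf : WellFounded fun β γ : ι => w β < w γ := by
    rw [WellFounded.wellFounded_iff_has_min]
    rintro A ⟨a, ha⟩
    by_cases hA : ∃ b ∈ A, w b < w a
    · obtain ⟨b, hb, hba⟩ := hA
      obtain ⟨m, hm, hmin⟩ := ((hw (w a)).inter_of_left A).exists_minimalFor w _ ⟨b, hba, hb⟩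
        |>.imp fun m h => h
      refine ⟨m, hm.2, fun x hx hxm => ?_⟩
      exact (hmin ⟨hxm.trans hm.1, hx⟩ hxm.le).not_gt hxm
    · exact ⟨a, ha, fun x hx hxa => hA ⟨x, hx, hxa⟩⟩
  set h : ι → K := hwf.fix fun γ ih =>
    g γ + ∑ β ∈ (hw (w γ)).toFinset.attach,
      ih β.1 ((hw (w γ)).mem_toFinset.mp β.2) * s β.1 γ with hdef
  have hrec : ∀ γ, h γ = g γ + ∑ β ∈ (hw (w γ)).toFinset, h β * s β γ := by
    intro γ
    conv_lhs => rw [hdef, hwf.fix_eq]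
    rw [← Finset.sum_attach (hw (w γ)).toFinset]
  refine ⟨h, hrec, ?_, ?_⟩
  · set C := ∑' β, ‖g β‖ * r β with hC
    have hpos : ∀ β, 0 ≤ ‖h β‖ * r β := fun β => mul_nonneg (norm_nonneg _) (hr β)
    -- The equations for the indices below a given level form a finite system, so the norm of the
    -- solution there is a finite number and can be absorbed.
    have hlevel : ∀ c, ∑ γ ∈ (hw c).toFinset, ‖h γ‖ * r γ ≤ 2 * C := by
      intro c
      have h1 : ∑ γ ∈ (hw c).toFinset, ‖h γ‖ * r γ ≤
          ∑ γ ∈ (hw c).toFinset, (‖g γ‖ * r γ +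
            ∑ β ∈ (hw c).toFinset, ‖h β‖ * (‖s β γ‖ * r γ)) := by
        refine Finset.sum_le_sum fun γ hγ => ?_
        have hγ' : w γ < c := by simpa using hγ
        have h2 : ‖h γ‖ ≤ ‖g γ‖ + ∑ β ∈ (hw c).toFinset, ‖h β‖ * ‖s β γ‖ := by
          calc ‖h γ‖ = ‖g γ + ∑ β ∈ (hw (w γ)).toFinset, h β * s β γ‖ :=
                congrArg _ (hrec γ)
            _ ≤ ‖g γ‖ + ∑ β ∈ (hw (w γ)).toFinset, ‖h β * s β γ‖ :=
                (norm_add_le _ _).trans (by gcongr; exact norm_sum_le _ _)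
            _ ≤ _ := by
                simp only [norm_mul]
                gcongr
        calc ‖h γ‖ * r γ ≤ (‖g γ‖ + ∑ β ∈ (hw c).toFinset, ‖h β‖ * ‖s β γ‖) * r γ :=
              mul_le_mul_of_nonneg_right h2 (hr γ)
          _ = _ := by rw [add_mul, Finset.sum_mul]; simp only [mul_assoc]
      rw [Finset.sum_add_distrib, Finset.sum_comm] at h1
      have h3 : ∑ γ ∈ (hw c).toFinset, ‖g γ‖ * r γ ≤ C :=
        hg.sum_le_tsum _ fun β _ => mul_nonneg (norm_nonneg _) (hr β)
      have h4 : ∑ β ∈ (hw c).toFinset, ∑ γ ∈ (hw c).toFinset, ‖h β‖ * (‖s β γ‖ * r γ) ≤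
          1 / 2 * ∑ β ∈ (hw c).toFinset, ‖h β‖ * r β := by
        rw [Finset.mul_sum]
        refine Finset.sum_le_sum fun β _ => ?_
        rw [← Finset.mul_sum]
        calc ‖h β‖ * ∑ γ ∈ (hw c).toFinset, ‖s β γ‖ * r γ ≤ ‖h β‖ * (1 / 2 * r β) :=
              mul_le_mul_of_nonneg_left (hnorm _ _) (norm_nonneg _)
          _ = _ := by ring
      linarith
    refine summable_of_sum_le hpos (c := 2 * C) fun T => ?_
    obtain ⟨c, hc⟩ : ∃ c, ∀ β ∈ T, w β < c := by
      obtain ⟨M, hM⟩ := (T.image w).bddAbove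
      exact ⟨M + 1, fun β hβ => (hM (Finset.mem_coe.mpr (Finset.mem_image_of_mem w hβ))).trans_lt
        (lt_add_one M)⟩
    refine le_trans (Finset.sum_le_sum_of_subset_of_nonneg (fun β hβ => ?_)
      fun β _ _ => hpos β) (hlevel c)
    simpa using hc β hβ
  · intro U hgU hsU β
    induction β using hwf.induction with
    | _ γ ih =>
      intro hγ
      by_contra hγU
      refine hγ ?_
      rw [hrec γ, not_not.mp fun h0 => hγU (hgU γ h0), zero_add]
      refine Finset.sum_eq_zero fun β hβ => ?_
      by_contra h0
      have hβ' : w β < w γ := by simpa using hβ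
      exact hγU (hsU β (ih β hβ' (left_ne_zero_of_mul h0)) γ (right_ne_zero_of_mul h0))

/-! ### Division of convergent power series -/

section Division

variable {K : Type*} [RCLike K] {n : ℕ} {lam : Fin n → ℝ}

theorem isConvergent_monomial (δ : Fin n →₀ ℕ) (c : K) :
    IsConvergent (monomial δ c : MvPowerSeries (Fin n) K) := by
  classical
  refine ⟨1, one_pos, summable_of_ne_finset_zero (s := {δ}) fun β hβ => ?_⟩
  rw [coeff_monomial_ne (by simpa using hβ)]
  simp

theorem sum_norm_coeff_monomial_mul_le {F : MvPowerSeries (Fin n) K} {t : ℝ} (ht : 0 < t)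
    (hF : Summable fun β => ‖coeff β F‖ * t ^ linForm lam β) (δ : Fin n →₀ ℕ)
    (T : Finset (Fin n →₀ ℕ)) :
    ∑ γ ∈ T, ‖coeff γ (monomial δ 1 * F)‖ * t ^ linForm lam γ ≤
      t ^ linForm lam δ * ∑' β, ‖coeff β F‖ * t ^ linForm lam β := by
  have hcomp : (fun γ => ‖coeff γ (monomial δ 1 * F)‖ * t ^ linForm lam γ) ∘ (δ + ·) =
      fun β => t ^ linForm lam δ * (‖coeff β F‖ * t ^ linForm lam β) := by
    funext β
    simp only [Function.comp_apply, coeff_add_monomial_mul, one_mul, linForm_add,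
      Real.rpow_add ht]
    ring
  have hinj : Function.Injective fun β : Fin n →₀ ℕ => δ + β := add_right_injective δ
  have hzero : ∀ γ ∉ Set.range fun β : Fin n →₀ ℕ => δ + β,
      ‖coeff γ (monomial δ 1 * F)‖ * t ^ linForm lam γ = 0 := by
    intro γ hγ
    rw [coeff_monomial_mul, if_neg, norm_zero, zero_mul]
    intro hle
    exact hγ ⟨γ - δ, add_tsub_cancel_of_le hle⟩
  have hsum : Summable fun γ => ‖coeff γ (monomial δ 1 * F)‖ * t ^ linForm lam γ := by
    rw [← hinj.summable_iff hzero, hcomp]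
    exact hF.mul_left _
  refine (hsum.sum_le_tsum T fun γ _ => by positivity).trans (le_of_eq ?_)
  rw [← tsum_mul_left, ← hinj.tsum_eq (Function.support_subset_iff'.mpr hzero)]
  exact tsum_congr fun β => congrFun hcomp β

/-- **Division theorem** of Grauert and Hironaka. The remainder has no exponent in the set
generated by the initial exponents of the divisors, and it keeps the initial exponent of the
dividend if that exponent is outside this set. -/
theorem exists_division (hlam : ∀ i, 0 < lam i) {ι : Type*} [Fintype ι]
    (F : ι → convergentSeries K n) (a : ι → Fin n →₀ ℕ)
    (hF : ∀ i, IsInitialExponent lam (F i : MvPowerSeries (Fin n) K) (a i))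
    (G : convergentSeries K n) :
    ∃ (Q : ι → convergentSeries K n) (R : convergentSeries K n),
      G = ∑ i, Q i * F i + R ∧
      (∀ β, coeff β (R : MvPowerSeries (Fin n) K) ≠ 0 → ∀ i, ¬ a i ≤ β) ∧
      ∀ β, IsInitialExponent lam (G : MvPowerSeries (Fin n) K) β → (∀ i, ¬ a i ≤ β) →
        coeff β (R : MvPowerSeries (Fin n) K) ≠ 0 := by
  classical
  obtain ⟨mu, hmu, hmuF⟩ := exists_linForm_of_expLT hlam a
  set c : ι → K := fun i => coeff (a i) (F i : MvPowerSeries (Fin n) K) with hc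
  have hc0 : ∀ i, c i ≠ 0 := fun i => (hF i).1
  set F' : ι → MvPowerSeries (Fin n) K :=
    fun i => (F i : MvPowerSeries (Fin n) K) - monomial (a i) (c i) with hF'
  have hFF' : ∀ i, (F i : MvPowerSeries (Fin n) K) = monomial (a i) (c i) + F' i := fun i => by
    simp [hF']
  have hF'conv : ∀ i, IsConvergent (F' i) := fun i =>
    (convergentSeries K n).sub_mem (F i).2 (isConvergent_monomial (a i) (c i))
  have hF'exp : ∀ i q, coeff q (F' i) ≠ 0 → expLT lam (a i) q := by
    intro i q hq
    have hne : q ≠ a i := by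
      rintro rfl
      simp [hF', hc] at hq
    rw [hF', map_sub, coeff_monomial_ne hne, sub_zero] at hq
    exact ((hF i).2 q hq).resolve_left hne
  obtain ⟨t, ⟨⟨hGt, ht1⟩, hF't⟩, ht⟩ :=
    (((IsConvergent.eventually_summable G.2 hmu).and
      ((eventually_lt_nhds one_pos).filter_mono nhdsWithin_le_nhds)).and
      (eventually_all.mpr fun i => (hF'conv i).eventually_tsum_le hmu
        (fun q hq => hmuF i q (hF'exp i q hq))
        (show 0 < 1 / 2 * ‖c i‖ by have := norm_pos_iff.mpr (hc0 i); positivity))).and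
      eventually_mem_nhdsWithin |>.exists
  have ht : 0 < t := ht
  obtain ⟨idx, hidx, hidx'⟩ : ∃ idx : (Fin n →₀ ℕ) → Option ι,
      (∀ β i, idx β = some i → a i ≤ β) ∧ ∀ β, idx β = none → ∀ i, ¬ a i ≤ β := by
    refine ⟨fun β => if h : ∃ i, a i ≤ β then some h.choose else none, fun β i h => ?_,
      fun β h => ?_⟩
    · simp only at h
      split_ifs at h with h'
      obtain rfl := Option.some_injective _ h
      exact h'.choose_spec
    · simp only at h
      split_ifs at h with h'
      exact not_exists.mp h'
  -- Replacing `x ^ β` by `(c i)⁻¹ x ^ (β - a i) F i` if `idx β = some i`, and keeping `x ^ β`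
  -- otherwise, is the operator `1 - S`, where `S` has the following matrix.
  set S : ι → (Fin n →₀ ℕ) → (Fin n →₀ ℕ) → K := fun i β γ =>
    if idx β = some i then -((c i)⁻¹ * coeff γ (monomial (β - a i) 1 * F' i)) else 0 with hS
  have hSne : ∀ i β γ, S i β γ ≠ 0 → idx β = some i ∧
      ∃ δ q, β = δ + a i ∧ γ = δ + q ∧ coeff q (F' i) ≠ 0 := by
    intro i β γ h
    simp only [hS] at h
    split_ifs at h with hi
    · rw [coeff_monomial_mul] at h
      split_ifs at h with hle
      · refine ⟨hi, β - a i, γ - (β - a i), (tsub_add_cancel_of_le (hidx β i hi)).symm,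
          (add_tsub_cancel_of_le hle).symm, fun h0 => h ?_⟩
        rw [h0]
        simp
      · simp at h
    · exact absurd rfl h
  have hSexp : ∀ β γ, ∑ i, S i β γ ≠ 0 → expLT lam β γ := by
    intro β γ h
    obtain ⟨i, -, hi⟩ := Finset.exists_ne_zero_of_sum_ne_zero h
    obtain ⟨-, δ, q, rfl, rfl, hq⟩ := hSne i β γ hi
    exact (hF'exp i q hq).add_left δ
  have hfin : ∀ b, {β | linForm mu β < b}.Finite := fun b =>
    (finite_linForm_le hmu b).subset fun β hβ => by
      simp only [Set.mem_ofPred_eq] at hβ ⊢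
      exact hβ.le
  have hnorm : ∀ β (T : Finset (Fin n →₀ ℕ)),
      ∑ γ ∈ T, ‖∑ i, S i β γ‖ * t ^ linForm mu γ ≤ 1 / 2 * t ^ linForm mu β := by
    intro β T
    rcases hi : idx β with _ | i
    · have h0 : ∀ γ i, S i β γ = 0 := fun γ i => by simp [hS, hi]
      simp only [h0, Finset.sum_const_zero, norm_zero, zero_mul]
      positivity
    · have h1 : ∀ γ, ‖∑ i, S i β γ‖ * t ^ linForm mu γ = ‖c i‖⁻¹ *
          (‖coeff γ (monomial (β - a i) 1 * F' i)‖ * t ^ linForm mu γ) := by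
        intro γ
        rw [Finset.sum_eq_single i (fun j _ hj => ?_) (by simp)]
        · simp only [hS, hi, if_true, norm_neg, norm_mul, norm_inv]
          ring
        · simp only [hS, hi]
          rw [if_neg]
          exact fun h => hj (Option.some_injective _ h).symm
      simp only [h1]
      rw [← Finset.mul_sum]
      have hcpos : 0 < ‖c i‖ := norm_pos_iff.mpr (hc0 i)
      have h2 : linForm mu β = linForm mu (β - a i) + linForm mu (a i) := by
        rw [← linForm_add, tsub_add_cancel_of_le (hidx β i hi)]
      calc _ ≤ ‖c i‖⁻¹ * (t ^ linForm mu (β - a i) *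
            (1 / 2 * ‖c i‖ * t ^ linForm mu (a i))) := by
            gcongr
            refine (sum_norm_coeff_monomial_mul_le ht (hF't i).1 _ T).trans ?_
            gcongr
            exact (hF't i).2
        _ = 1 / 2 * t ^ linForm mu β := by
            rw [h2, Real.rpow_add ht]
            field_simp
  obtain ⟨h, hrec, hsum, hsupp⟩ := exists_solution_of_triangular (linForm mu)
    (fun β => t ^ linForm mu β) hfin (fun β => by positivity) (fun β γ => ∑ i, S i β γ)
    hnorm
    (fun β => coeff β (G : MvPowerSeries (Fin n) K)) hGt
  set Q : ι → MvPowerSeries (Fin n) K := fun i p =>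
    if idx (p + a i) = some i then (c i)⁻¹ * h (p + a i) else 0 with hQ
  have hQcoeff : ∀ i p, coeff p (Q i) =
      if idx (p + a i) = some i then (c i)⁻¹ * h (p + a i) else 0 := fun i p => rfl
  set R : MvPowerSeries (Fin n) K := fun β => if idx β = none then h β else 0 with hR
  have hRcoeff : ∀ β, coeff β R = if idx β = none then h β else 0 := fun β => rfl
  have hRconv : IsConvergent R := by
    refine isConvergent_of_summable (lam := mu) ht ht1.le
      (Summable.of_nonneg_of_le (fun β => by positivity) (fun β => ?_) hsum)
    rw [hRcoeff]
    split_ifs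
    · rfl
    · rw [norm_zero, zero_mul]
      positivity
  have hQconv : ∀ i, IsConvergent (Q i) := by
    intro i
    refine isConvergent_of_summable (lam := mu) ht ht1.le
      (Summable.of_nonneg_of_le (fun β => by positivity) (fun p => ?_)
        ((hsum.comp_injective (add_left_injective (a i))).mul_left
          (‖c i‖⁻¹ * (t ^ linForm mu (a i))⁻¹)))
    rw [hQcoeff]
    split_ifs
    · simp only [Function.comp_apply, linForm_add, Real.rpow_add ht, norm_mul, norm_inv]
      have : 0 < t ^ linForm mu (a i) := by positivity
      apply le_of_eq
      field_simp
    · rw [norm_zero, zero_mul]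
      simp only [Function.comp_apply]
      positivity
  have hlead : ∀ γ i, coeff γ (Q i * monomial (a i) (c i)) =
      if idx γ = some i then h γ else 0 := by
    intro γ i
    rw [coeff_mul_monomial]
    by_cases hi : idx γ = some i
    · rw [if_pos (hidx γ i hi), hQcoeff, tsub_add_cancel_of_le (hidx γ i hi), if_pos hi,
        if_pos hi]
      field_simp [hc0 i]
    · rw [if_neg hi]
      split_ifs with hle
      · rw [hQcoeff, tsub_add_cancel_of_le hle, if_neg hi, zero_mul]
      · rfl
  have htail : ∀ γ i, coeff γ (Q i * F' i) =
      -∑ β ∈ (hfin (linForm mu γ)).toFinset, h β * S i β γ := by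
    intro γ i
    rw [coeff_mul, ← Finset.sum_neg_distrib]
    refine Finset.sum_bij_ne_zero (fun p _ _ => p.1 + a i) ?_ ?_ ?_ ?_
    · rintro ⟨p, q⟩ hp hne
      obtain rfl := Finset.HasAntidiagonal.mem_antidiagonal.mp hp
      simp only [Set.Finite.mem_toFinset, Set.mem_ofPred_eq, linForm_add]
      have := hmuF i q (hF'exp i q (right_ne_zero_of_mul hne))
      linarith
    · rintro ⟨p, q⟩ hp - ⟨p', q'⟩ hp' - heq
      have h1 : p = p' := add_right_cancel heq
      subst h1
      have h2 := (Finset.HasAntidiagonal.mem_antidiagonal.mp hp).trans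
        (Finset.HasAntidiagonal.mem_antidiagonal.mp hp').symm
      exact congrArg _ (add_left_cancel h2)
    · intro β _ hne
      obtain ⟨-, δ, q, rfl, rfl, hq⟩ := hSne i β γ
        (right_ne_zero_of_mul (neg_ne_zero.mp hne))
      have hi := (hSne i _ _ (right_ne_zero_of_mul (neg_ne_zero.mp hne))).1
      refine ⟨(δ, q), Finset.HasAntidiagonal.mem_antidiagonal.mpr rfl, ?_, rfl⟩
      rw [hQcoeff, if_pos hi]
      exact mul_ne_zero (mul_ne_zero (inv_ne_zero (hc0 i))
        (left_ne_zero_of_mul (neg_ne_zero.mp hne))) hq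
    · rintro ⟨p, q⟩ hp hne
      obtain rfl := Finset.HasAntidiagonal.mem_antidiagonal.mp hp
      have hi : idx (p + a i) = some i := by
        by_contra hi
        rw [hQcoeff, if_neg hi, zero_mul] at hne
        exact hne rfl
      simp only [hS, hQcoeff, if_pos hi, add_tsub_cancel_right, coeff_add_monomial_mul]
      ring
  refine ⟨fun i => ⟨Q i, hQconv i⟩, ⟨R, hRconv⟩, ?_, fun β hβ => ?_, fun β hβ hβa => ?_⟩
  · apply Subtype.ext
    ext γ
    have hsumeq : ((∑ i, (⟨Q i, hQconv i⟩ : convergentSeries K n) * F i +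
        ⟨R, hRconv⟩ : convergentSeries K n) : MvPowerSeries (Fin n) K) =
        ∑ i, Q i * (F i : MvPowerSeries (Fin n) K) + R := by
      simp
    rw [hsumeq, map_add, map_sum]
    simp only [hFF', mul_add, map_add, hlead, htail, Finset.sum_add_distrib,
      Finset.sum_neg_distrib]
    have h1 := hrec γ
    simp only [Finset.mul_sum] at h1
    rw [Finset.sum_comm] at h1
    have h2 : ∑ i, (if idx γ = some i then h γ else 0) + coeff γ R = h γ := by
      rw [hRcoeff]
      rcases hi : idx γ with _ | i
      · simp
      · simp
    linear_combination -h1 - h2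
  · by_cases hi : idx β = none
    · exact hidx' β hi
    · rw [hRcoeff, if_neg hi] at hβ
      exact absurd rfl hβ
  · have hi : idx β = none := by
      rcases hi : idx β with _ | i
      · rfl
      · exact absurd (hidx β i hi) (hβa i)
    have hU := hsupp {γ | γ = β ∨ expLT lam β γ} (fun γ hγ => hβ.2 γ hγ) (by
      rintro γ (rfl | hγ) δ hδ
      · exact Or.inr (hSexp _ _ hδ)
      · exact Or.inr (hγ.trans (hSexp _ _ hδ)))
    rw [hRcoeff, if_pos hi, hrec β, Finset.sum_eq_zero, add_zero]
    · exact hβ.1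
    · intro γ _
      by_contra hne
      have h1 := hSexp _ _ (right_ne_zero_of_mul hne)
      rcases hU γ (left_ne_zero_of_mul hne) with rfl | h2
      · exact expLT_irrefl _ h1
      · exact expLT_irrefl _ (h1.trans h2)

end Division

/-! ### Standard bases, and the ring of convergent power series -/

section StandardBasis

variable {K : Type*} [RCLike K] {n : ℕ} {lam : Fin n → ℝ}

theorem exists_standardBasis (lam : Fin n → ℝ) (I : Ideal (convergentSeries K n)) :
    ∃ (T : Finset (Fin n →₀ ℕ)) (F : T → convergentSeries K n), (∀ i, F i ∈ I) ∧
      (∀ i, IsInitialExponent lam (F i : MvPowerSeries (Fin n) K) i) ∧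
      ∀ β ∈ diagram lam I, ∃ i : T, (i : Fin n →₀ ℕ) ≤ β := by
  obtain ⟨T, hTS, hT, hcover⟩ := exists_finite_generators (S := diagram lam I)
  have hT' : ∀ i : hT.toFinset, ∃ F ∈ I, F ≠ 0 ∧
      IsInitialExponent lam (F : MvPowerSeries (Fin n) K) i := fun i =>
    hTS (hT.mem_toFinset.mp i.2)
  choose F hFI _ hF using hT'
  refine ⟨hT.toFinset, F, hFI, hF, fun β hβ => ?_⟩
  obtain ⟨α, hα, hle⟩ := hcover β hβ
  exact ⟨⟨α, hT.mem_toFinset.mpr hα⟩, hle⟩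

theorem eq_zero_of_mem_of_support (hlam : ∀ i, 0 < lam i) {I : Ideal (convergentSeries K n)}
    {G : convergentSeries K n} (hG : G ∈ I)
    (hsupp : ∀ β, coeff β (G : MvPowerSeries (Fin n) K) ≠ 0 → β ∉ diagram lam I) : G = 0 := by
  by_contra hne
  obtain ⟨β, hβ⟩ := exists_isInitialExponent hlam
    (F := (G : MvPowerSeries (Fin n) K)) (fun h => hne (Subtype.ext h))
  exact hsupp β hβ.1 ⟨G, hG, hne, hβ⟩

theorem exists_normalForm (hlam : ∀ i, 0 < lam i) (I : Ideal (convergentSeries K n))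
    (G : convergentSeries K n) :
    ∃ R : convergentSeries K n, G - R ∈ I ∧
      ∀ β, coeff β (R : MvPowerSeries (Fin n) K) ≠ 0 → β ∉ diagram lam I := by
  obtain ⟨T, F, hFI, hF, hcover⟩ := exists_standardBasis lam I
  obtain ⟨Q, R, hG, hR, -⟩ := exists_division hlam F _ hF G
  refine ⟨R, ?_, fun β hβ hβI => ?_⟩
  · rw [hG, add_sub_cancel_right]
    exact I.sum_mem fun i _ => I.mul_mem_left _ (hFI i)
  · obtain ⟨i, hi⟩ := hcover β hβI
    exact hR β hβ i hi

/-- By division, a standard basis of an ideal generates the ideal. -/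
instance isNoetherianRing_convergentSeries : IsNoetherianRing (convergentSeries K n) := by
  have hlam : ∀ i : Fin n, (0 : ℝ) < (fun _ => 1 : Fin n → ℝ) i := fun _ => one_pos
  refine (isNoetherianRing_iff_ideal_fg _).mpr fun I => ?_
  obtain ⟨T, F, hFI, hF, hcover⟩ := exists_standardBasis (fun _ => (1 : ℝ)) I
  have hle : Ideal.span (Set.range F) ≤ I := Ideal.span_le.mpr (by rintro _ ⟨i, rfl⟩; exact hFI i)
  suffices h : I = Ideal.span (Set.range F) by
    rw [h]
    exact Submodule.fg_span (Set.finite_range F)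
  refine le_antisymm (fun G hG => ?_) hle
  obtain ⟨Q, R, hGR, hR, -⟩ := exists_division hlam F _ hF G
  have hQ : ∑ i, Q i * F i ∈ Ideal.span (Set.range F) :=
    Ideal.sum_mem _ fun i _ => Ideal.mul_mem_left _ _ (Ideal.subset_span ⟨i, rfl⟩)
  have hRI : R ∈ I := by
    rw [show R = G - ∑ i, Q i * F i by rw [hGR, add_sub_cancel_left]]
    exact I.sub_mem hG (hle hQ)
  have hR0 : R = 0 := eq_zero_of_mem_of_support hlam hRI fun β hβ hβI => by
    obtain ⟨i, hi⟩ := hcover β hβI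
    exact hR β hβ i hi
  rw [hGR, hR0, add_zero]
  exact hQ

theorem isUnit_iff_coeff_zero_ne_zero (F : convergentSeries K n) :
    IsUnit F ↔ coeff 0 (F : MvPowerSeries (Fin n) K) ≠ 0 := by
  constructor
  · intro h
    have h1 := (h.map (convergentSeries K n).val).map (constantCoeff (σ := Fin n) (R := K))
    rw [coeff_zero_eq_constantCoeff_apply]
    exact h1.ne_zero
  · intro h
    have hlam : ∀ i : Fin n, (0 : ℝ) < (fun _ => 1 : Fin n → ℝ) i := fun _ => one_pos
    -- Division by a series with initial exponent `0` leaves no remainder.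
    obtain ⟨Q, R, h1, hR, -⟩ := exists_division hlam (fun _ : Unit => F) (fun _ => 0)
      (fun _ => ⟨h, fun γ _ => or_iff_not_imp_left.mpr fun hγ =>
        expLT_of_le_of_ne hlam zero_le (Ne.symm hγ)⟩) 1
    have hR0 : R = 0 := by
      apply Subtype.ext
      ext β
      by_contra hβ
      exact hR β (by simpa using hβ) () zero_le
    rw [hR0, add_zero, Fintype.sum_unique] at h1
    exact IsUnit.of_mul_eq_one (Q default) (by rw [mul_comm, ← h1])

instance isLocalRing_convergentSeries : IsLocalRing (convergentSeries K n) := by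
  have : Nontrivial (convergentSeries K n) := inferInstance
  refine IsLocalRing.of_nonunits_add fun F G hF hG => ?_
  simp only [mem_nonunits_iff, isUnit_iff_coeff_zero_ne_zero, not_not] at hF hG ⊢
  rw [AddMemClass.coe_add, map_add, hF, hG, add_zero]

/-- The monomial `x^β` as a convergent power series. -/
noncomputable def convMonomial (K : Type*) [RCLike K] {n : ℕ} (β : Fin n →₀ ℕ) :
    convergentSeries K n :=
  ⟨monomial β 1, isConvergent_monomial β 1⟩

@[simp]
theorem coe_convMonomial (β : Fin n →₀ ℕ) :
    (convMonomial K β : MvPowerSeries (Fin n) K) = monomial β 1 := rfl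

theorem convMonomial_add (β γ : Fin n →₀ ℕ) :
    convMonomial K (β + γ) = convMonomial K β * convMonomial K γ := by
  apply Subtype.ext
  simp [monomial_mul_monomial]

theorem exists_eq_sum_mul_convMonomial {ι : Type*} [Fintype ι] (a : ι → Fin n →₀ ℕ)
    (F : convergentSeries K n)
    (hF : ∀ β, coeff β (F : MvPowerSeries (Fin n) K) ≠ 0 → ∃ i, a i ≤ β) :
    ∃ Q : ι → convergentSeries K n, F = ∑ i, Q i * convMonomial K (a i) := by
  have hlam : ∀ i : Fin n, (0 : ℝ) < (fun _ => 1 : Fin n → ℝ) i := fun _ => one_pos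
  obtain ⟨Q, R, h1, hR, -⟩ := exists_division hlam (fun i => convMonomial K (a i)) a
    (fun i => ⟨by simp, fun γ hγ => Or.inl (eq_of_coeff_monomial_ne_zero hγ)⟩) F
  refine ⟨Q, ?_⟩
  suffices hR0 : R = 0 by rwa [hR0, add_zero] at h1
  apply Subtype.ext
  ext β
  by_contra hβ
  have hβ' := hR β (by simpa using hβ)
  have h2 := congrArg (fun G : convergentSeries K n => coeff β (G : MvPowerSeries (Fin n) K)) h1
  have h3 : coeff β (F : MvPowerSeries (Fin n) K) = 0 := by
    by_contra h
    obtain ⟨i, hi⟩ := hF β h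
    exact hβ' i hi
  have h4 : ((∑ i, Q i * convMonomial K (a i) + R : convergentSeries K n) :
      MvPowerSeries (Fin n) K) = ∑ i, (Q i : MvPowerSeries (Fin n) K) * monomial (a i) 1 + R := by
    simp
  simp only [h3, h4, map_add, map_sum] at h2
  rw [Finset.sum_eq_zero fun i _ => by rw [coeff_mul_monomial, if_neg (hβ' i)], zero_add] at h2
  exact hβ (by simpa using h2.symm)

theorem convMonomial_mem_maximalIdeal_pow (β : Fin n →₀ ℕ) :
    convMonomial K β ∈ IsLocalRing.maximalIdeal (convergentSeries K n) ^ β.degree := by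
  induction β using Finsupp.induction_linear with
  | zero => simp
  | add f g hf hg =>
    rw [convMonomial_add, map_add, pow_add]
    exact Ideal.mul_mem_mul hf hg
  | single i m =>
    induction m with
    | zero => simp
    | succ m ih =>
      rw [Finsupp.single_add, convMonomial_add, map_add, pow_add]
      refine Ideal.mul_mem_mul ih ?_
      rw [Finsupp.degree_single, pow_one, IsLocalRing.mem_maximalIdeal, mem_nonunits_iff,
        isUnit_iff_coeff_zero_ne_zero, not_not, coe_convMonomial]
      exact coeff_monomial_ne (by simp [eq_comm]) 1

theorem finite_degree_eq (n p : ℕ) : {β : Fin n →₀ ℕ | β.degree = p}.Finite := by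
  refine (finite_linForm_le (lam := fun _ => (1 : ℝ)) (fun _ => one_pos) p).subset fun β hβ => ?_
  have h := linForm_le_mul_degree (lam := fun _ => (1 : ℝ)) (m := 1) (fun _ => le_rfl) β
  simp only [Set.mem_ofPred_eq] at hβ ⊢
  rwa [one_mul, hβ] at h

theorem exists_le_degree_eq {β : Fin n →₀ ℕ} {p : ℕ} (h : p ≤ β.degree) :
    ∃ γ ≤ β, γ.degree = p := by
  induction p with
  | zero => exact ⟨0, zero_le, by simp⟩
  | succ p ih =>
    obtain ⟨γ, hγ, hdeg⟩ := ih (by omega)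
    obtain ⟨δ, rfl⟩ := exists_add_of_le hγ
    have hδ : δ ≠ 0 := by
      rintro rfl
      rw [add_zero] at h
      omega
    obtain ⟨i, hi⟩ := Finsupp.ne_iff.mp hδ
    refine ⟨γ + Finsupp.single i 1, add_le_add_right ?_ γ, by simp [hdeg]⟩
    rw [Finsupp.single_le_iff]
    exact Nat.one_le_iff_ne_zero.mpr hi

theorem mem_maximalIdeal_pow_of_support {F : convergentSeries K n} {p : ℕ}
    (hF : ∀ β, coeff β (F : MvPowerSeries (Fin n) K) ≠ 0 → p ≤ β.degree) :
    F ∈ IsLocalRing.maximalIdeal (convergentSeries K n) ^ p := by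
  have := (finite_degree_eq n p).fintype
  obtain ⟨Q, hQ⟩ := exists_eq_sum_mul_convMonomial
    (fun i : {β : Fin n →₀ ℕ | β.degree = p} => (i : Fin n →₀ ℕ)) F fun β hβ => by
      obtain ⟨γ, hγ, hdeg⟩ := exists_le_degree_eq (hF β hβ)
      exact ⟨⟨γ, hdeg⟩, hγ⟩
  rw [hQ]
  refine Ideal.sum_mem _ fun i _ => Ideal.mul_mem_left _ _ ?_
  have h := convMonomial_mem_maximalIdeal_pow (K := K) (i : Fin n →₀ ℕ)
  rwa [show (i : Fin n →₀ ℕ).degree = p from i.2] at h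

/-- Submodules of `K{x}^m` are closed in the topology of the powers of the maximal ideal. -/
theorem mem_of_forall_exists_sub_mem_pow {m : ℕ}
    (N : Submodule (convergentSeries K n) (Fin m → convergentSeries K n))
    (r : Fin m → convergentSeries K n)
    (h : ∀ p, ∃ v ∈ N, ∀ i, r i - v i ∈ IsLocalRing.maximalIdeal (convergentSeries K n) ^ p) :
    r ∈ N := by
  rw [← Submodule.Quotient.mk_eq_zero, ← Submodule.mem_bot (convergentSeries K n),
    ← Ideal.iInf_pow_smul_eq_bot_of_isLocalRing
      (IsLocalRing.maximalIdeal (convergentSeries K n)) Ideal.IsPrime.ne_top', Submodule.mem_iInf]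
  intro p
  obtain ⟨v, hv, hrv⟩ := h p
  have h1 : (Submodule.Quotient.mk r : (Fin m → convergentSeries K n) ⧸ N) =
      N.mkQ (∑ i, (r i - v i) • Pi.single i 1) := by
    rw [Submodule.mkQ_apply, Submodule.Quotient.eq]
    convert hv using 1
    ext1 i
    simp [Finset.sum_apply, Pi.single_apply]
  rw [h1, map_sum]
  refine Submodule.sum_mem _ fun i _ => ?_
  rw [map_smul]
  exact Submodule.smul_mem_smul (hrv i) trivial

end StandardBasis

/-! ### Splitting exponents into head and tail -/

section HeadTail

variable {n k : ℕ}

/-- The exponent of `x` that extends an exponent of `x̃` by `0`. -/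
noncomputable def tailEmb (n k : ℕ) (γ : Fin (n - k) →₀ ℕ) : Fin n →₀ ℕ :=
  γ.mapDomain (tailIndex n k)

/-- The entries of an exponent at the variables of `x̃`. -/
noncomputable def tailPart (k : ℕ) (β : Fin n →₀ ℕ) : Fin (n - k) →₀ ℕ :=
  β.comapDomain (tailIndex n k) (tailIndex_injective n k).injOn

/-- The exponent obtained by replacing the entries at the variables of `x̃` by `0`. -/
noncomputable def headPart (k : ℕ) (β : Fin n →₀ ℕ) : Fin n →₀ ℕ :=
  β.filter fun i => (i : ℕ) < k

theorem tailEmb_apply_tailIndex (γ : Fin (n - k) →₀ ℕ) (j : Fin (n - k)) :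
    tailEmb n k γ (tailIndex n k j) = γ j :=
  Finsupp.mapDomain_apply (tailIndex_injective n k) _ _

theorem tailEmb_apply_of_lt (γ : Fin (n - k) →₀ ℕ) {i : Fin n} (hi : (i : ℕ) < k) :
    tailEmb n k γ i = 0 := by
  refine Finsupp.mapDomain_of_notMem_range _ _ ?_
  rintro ⟨j, rfl⟩
  simp only [tailIndex] at hi
  omega

theorem exists_tailIndex_eq {i : Fin n} (hi : ¬ (i : ℕ) < k) : ∃ j, tailIndex n k j = i :=
  ⟨⟨i - k, by omega⟩, Fin.ext (by simp only [tailIndex]; omega)⟩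

theorem headPart_apply_of_lt (β : Fin n →₀ ℕ) {i : Fin n} (hi : (i : ℕ) < k) :
    headPart k β i = β i :=
  Finsupp.filter_apply_pos _ _ hi

theorem headPart_apply_of_not_lt (β : Fin n →₀ ℕ) {i : Fin n} (hi : ¬ (i : ℕ) < k) :
    headPart k β i = 0 :=
  Finsupp.filter_apply_neg _ _ hi

theorem headPart_add_tailEmb (k : ℕ) (β : Fin n →₀ ℕ) :
    headPart k β + tailEmb n k (tailPart k β) = β := by
  ext i
  rw [Finsupp.add_apply]
  by_cases hi : (i : ℕ) < k
  · rw [headPart_apply_of_lt β hi, tailEmb_apply_of_lt _ hi, add_zero]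
  · obtain ⟨j, rfl⟩ := exists_tailIndex_eq hi
    rw [headPart_apply_of_not_lt β hi, tailEmb_apply_tailIndex, zero_add]
    rfl

theorem headPart_add (β γ : Fin n →₀ ℕ) : headPart k (β + γ) = headPart k β + headPart k γ :=
  Finsupp.filter_add

theorem tailPart_add (β γ : Fin n →₀ ℕ) : tailPart k (β + γ) = tailPart k β + tailPart k γ := by
  ext j
  rfl

theorem tailEmb_add (β γ : Fin (n - k) →₀ ℕ) :
    tailEmb n k (β + γ) = tailEmb n k β + tailEmb n k γ :=
  Finsupp.mapDomain_add

@[simp]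
theorem headPart_tailEmb (γ : Fin (n - k) →₀ ℕ) : headPart k (tailEmb n k γ) = 0 := by
  ext i
  by_cases hi : (i : ℕ) < k
  · rw [headPart_apply_of_lt _ hi, tailEmb_apply_of_lt _ hi, Finsupp.zero_apply]
  · rw [headPart_apply_of_not_lt _ hi, Finsupp.zero_apply]

@[simp]
theorem tailPart_tailEmb (γ : Fin (n - k) →₀ ℕ) : tailPart k (tailEmb n k γ) = γ := by
  ext j
  exact tailEmb_apply_tailIndex γ j

@[simp]
theorem headPart_headPart (β : Fin n →₀ ℕ) : headPart k (headPart k β) = headPart k β := by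
  ext i
  by_cases hi : (i : ℕ) < k
  · rw [headPart_apply_of_lt _ hi]
  · rw [headPart_apply_of_not_lt _ hi, headPart_apply_of_not_lt _ hi]

@[simp]
theorem tailPart_headPart (β : Fin n →₀ ℕ) : tailPart k (headPart k β) = 0 := by
  ext j
  refine headPart_apply_of_not_lt _ ?_
  simp [tailIndex]

theorem headPart_le (β : Fin n →₀ ℕ) : headPart k β ≤ β := by
  conv_rhs => rw [← headPart_add_tailEmb k β]
  exact le_self_add

@[simp]
theorem degree_tailEmb (γ : Fin (n - k) →₀ ℕ) : (tailEmb n k γ).degree = γ.degree :=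
  Finsupp.degree_mapDomain _ _

theorem degree_eq_add (k : ℕ) (β : Fin n →₀ ℕ) :
    β.degree = (headPart k β).degree + (tailPart k β).degree := by
  conv_lhs => rw [← headPart_add_tailEmb k β, map_add, degree_tailEmb]

theorem mem_cylinder_iff (h : k ≤ n) {D : Set (Fin k →₀ ℕ)} {β : Fin n →₀ ℕ} :
    β ∈ cylinder h D ↔ headPart k β ∈ cylinder h D := by
  have heq : β.comapDomain (Fin.castLE h) (Fin.castLE_injective h).injOn =
      (headPart k β).comapDomain (Fin.castLE h) (Fin.castLE_injective h).injOn := by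
    ext i
    exact (headPart_apply_of_lt β (i := Fin.castLE h i) i.2).symm
  simp only [cylinder, Set.mem_ofPred_eq, heq]

/-- A set of exponents that does not restrict the tail is a cylinder. -/
theorem exists_eq_cylinder (h : k ≤ n) (S : Set (Fin n →₀ ℕ)) :
    ∃ D : Set (Fin k →₀ ℕ), cylinder h D = {β | headPart k β ∈ S} := by
  refine ⟨{α | α.mapDomain (Fin.castLE h) ∈ S}, ?_⟩
  ext β
  have heq : (β.comapDomain (Fin.castLE h) (Fin.castLE_injective h).injOn).mapDomain
      (Fin.castLE h) = headPart k β := by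
    ext i
    by_cases hi : (i : ℕ) < k
    · have h1 : i = Fin.castLE h ⟨i, hi⟩ := rfl
      rw [headPart_apply_of_lt _ hi, h1, Finsupp.mapDomain_apply (Fin.castLE_injective h)]
      rfl
    · rw [headPart_apply_of_not_lt _ hi]
      refine Finsupp.mapDomain_of_notMem_range _ _ ?_
      rintro ⟨j, rfl⟩
      exact hi j.2
  simp only [cylinder, Set.mem_ofPred_eq, heq]

end HeadTail

/-! ### Coefficients of a power series over the ring in the tail variables -/

section Slice

variable {K : Type*} [RCLike K] {n k : ℕ}

theorem coeff_tailInclusion_tailEmb (G : convergentSeries K (n - k)) (γ : Fin (n - k) →₀ ℕ) :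
    coeff (tailEmb n k γ) (tailInclusion K n k G : MvPowerSeries (Fin n) K) =
      coeff γ (G : MvPowerSeries (Fin (n - k)) K) := by
  have h := coeff_embDomain_rename ⟨tailIndex n k, tailIndex_injective n k⟩
    (G : MvPowerSeries (Fin (n - k)) K) γ
  rw [Finsupp.embDomain_eq_mapDomain] at h
  exact h

theorem headPart_eq_zero_of_coeff_tailInclusion {G : convergentSeries K (n - k)}
    {β : Fin n →₀ ℕ}
    (h : coeff β (tailInclusion K n k G : MvPowerSeries (Fin n) K) ≠ 0) : headPart k β = 0 := by
  by_contra hβ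
  refine h (coeff_rename_eq_zero _ _ ?_)
  rintro ⟨γ, rfl⟩
  exact hβ (headPart_tailEmb γ)

theorem exists_tailEmb_of_headPart_eq_zero {β : Fin n →₀ ℕ} (h : headPart k β = 0) :
    β = tailEmb n k (tailPart k β) := by
  conv_lhs => rw [← headPart_add_tailEmb k β, h, zero_add]

theorem tailInclusion_convMonomial (γ : Fin (n - k) →₀ ℕ) :
    tailInclusion K n k (convMonomial K γ) = convMonomial K (tailEmb n k γ) := by
  classical
  apply Subtype.ext
  ext β
  by_cases h : headPart k β = 0
  · rw [exists_tailEmb_of_headPart_eq_zero h, coeff_tailInclusion_tailEmb, coe_convMonomial,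
      coe_convMonomial, coeff_monomial, coeff_monomial]
    refine if_congr ⟨fun h => by rw [h], fun h => ?_⟩ rfl rfl
    simpa using congrArg (tailPart k) h
  · rw [coe_convMonomial, coeff_monomial_ne]
    · by_contra h'
      exact h (headPart_eq_zero_of_coeff_tailInclusion h')
    · rintro rfl
      exact h (headPart_tailEmb γ)

theorem isConvergent_slice (β : Fin n →₀ ℕ) (F : convergentSeries K n) :
    IsConvergent (fun γ => coeff (β + tailEmb n k γ) (F : MvPowerSeries (Fin n) K) :
      MvPowerSeries (Fin (n - k)) K) := by
  obtain ⟨r, hr, hF⟩ := F.2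
  have hinj : Function.Injective fun γ => β + tailEmb n k γ :=
    (add_right_injective β).comp (Finsupp.mapDomain_injective (tailIndex_injective n k))
  refine ⟨r, hr, ((hF.comp_injective hinj).mul_left (r ^ β.degree)⁻¹).congr fun γ => ?_⟩
  simp only [Function.comp_apply, map_add, degree_tailEmb, pow_add]
  rw [show coeff γ (fun γ => coeff (β + tailEmb n k γ) (F : MvPowerSeries (Fin n) K) :
      MvPowerSeries (Fin (n - k)) K) = coeff (β + tailEmb n k γ) (F : MvPowerSeries (Fin n) K)
    from rfl]
  field_simp

/-- For an exponent `β` of the head variables, the coefficient of `x^β` in `F`, as a convergent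
power series in the tail variables `x̃`. -/
noncomputable def slice (k : ℕ) (β : Fin n →₀ ℕ) :
    convergentSeries K n →+ convergentSeries K (n - k) where
  toFun F := ⟨fun γ => coeff (β + tailEmb n k γ) (F : MvPowerSeries (Fin n) K),
    isConvergent_slice β F⟩
  map_zero' := by
    apply Subtype.ext
    ext γ
    exact map_zero (coeff (β + tailEmb n k γ))
  map_add' F G := by
    apply Subtype.ext
    ext γ
    exact map_add (coeff (β + tailEmb n k γ)) _ _

theorem coeff_slice (β : Fin n →₀ ℕ) (F : convergentSeries K n) (γ : Fin (n - k) →₀ ℕ) :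
    coeff γ (slice k β F : MvPowerSeries (Fin (n - k)) K) =
      coeff (β + tailEmb n k γ) (F : MvPowerSeries (Fin n) K) := rfl

theorem slice_tailInclusion_mul {β : Fin n →₀ ℕ} (hβ : headPart k β = β)
    (G : convergentSeries K (n - k)) (F : convergentSeries K n) :
    slice k β (tailInclusion K n k G * F) = G * slice k β F := by
  classical
  have hβ' : tailPart k β = 0 := by rw [← hβ, tailPart_headPart]
  apply Subtype.ext
  ext γ
  rw [coeff_slice, MulMemClass.coe_mul, MulMemClass.coe_mul, coeff_mul, coeff_mul]
  symm
  refine Finset.sum_bij_ne_zero (fun p _ _ => (tailEmb n k p.1, β + tailEmb n k p.2)) ?_ ?_ ?_ ?_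
  · rintro ⟨p, q⟩ hp -
    rw [Finset.HasAntidiagonal.mem_antidiagonal] at hp ⊢
    rw [← hp, tailEmb_add]
    exact add_left_comm _ _ _
  · rintro ⟨p, q⟩ - - ⟨p', q'⟩ - - h
    obtain ⟨h1, h2⟩ := Prod.mk.inj h
    have h1 := congrArg (tailPart k) h1
    have h2 := congrArg (tailPart k) (add_left_cancel h2)
    simp only [tailPart_tailEmb] at h1 h2
    rw [h1, h2]
  · rintro ⟨u, v⟩ huv hne
    rw [Finset.HasAntidiagonal.mem_antidiagonal] at huv
    simp only at huv hne
    have hu0 := headPart_eq_zero_of_coeff_tailInclusion (left_ne_zero_of_mul hne)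
    have hu := exists_tailEmb_of_headPart_eq_zero hu0
    have h1 := congrArg (headPart k) huv
    rw [headPart_add, headPart_add, hu0, headPart_tailEmb, zero_add, add_zero, hβ] at h1
    have h2 := congrArg (tailPart k) huv
    rw [tailPart_add, tailPart_add, hβ', tailPart_tailEmb, zero_add] at h2
    have hv : β + tailEmb n k (tailPart k v) = v := by
      conv_rhs => rw [← headPart_add_tailEmb k v, h1]
    refine ⟨(tailPart k u, tailPart k v), Finset.HasAntidiagonal.mem_antidiagonal.mpr h2, ?_, ?_⟩
    · rwa [coeff_slice, hv, ← coeff_tailInclusion_tailEmb, ← hu]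
    · rw [hv, ← hu]
  · rintro ⟨p, q⟩ - -
    rw [coeff_tailInclusion_tailEmb, coeff_slice]

open Classical in
theorem coeff_convMonomial_mul_slice {β : Fin n →₀ ℕ} (hβ : headPart k β = β)
    (F : convergentSeries K n) (δ : Fin n →₀ ℕ) :
    coeff δ (convMonomial K β * tailInclusion K n k (slice k β F) : MvPowerSeries (Fin n) K) =
      if headPart k δ = β then coeff δ (F : MvPowerSeries (Fin n) K) else 0 := by
  split_ifs with h
  · have hδ : δ = β + tailEmb n k (tailPart k δ) := by
      conv_lhs => rw [← headPart_add_tailEmb k δ, h]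
    rw [hδ, coe_convMonomial, coeff_add_monomial_mul, coeff_tailInclusion_tailEmb, coeff_slice,
      one_mul]
  · rw [coe_convMonomial, coeff_monomial_mul]
    split_ifs with hle
    · rw [one_mul]
      by_contra hne
      obtain ⟨ε, rfl⟩ := exists_add_of_le hle
      rw [add_tsub_cancel_left] at hne
      rw [headPart_add, hβ, headPart_eq_zero_of_coeff_tailInclusion hne, add_zero] at h
      exact h rfl
    · rfl

/-- A submodule of `K{x}^m` contains a vector as soon as it contains the terms of its expansion
with respect to the head variables. -/
theorem mem_of_forall_slice_mem {m : ℕ}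
    (N : Submodule (convergentSeries K n) (Fin m → convergentSeries K n))
    (r : Fin m → convergentSeries K n)
    (h : ∀ β, headPart k β = β → (fun i => tailInclusion K n k (slice k β (r i))) ∈ N) :
    r ∈ N := by
  classical
  refine mem_of_forall_exists_sub_mem_pow N r fun p => ?_
  have hfin : {β : Fin n →₀ ℕ | headPart k β = β ∧ β.degree < p}.Finite := by
    refine ((Set.finite_lt_nat p).biUnion fun q _ => finite_degree_eq n q).subset fun β hβ => ?_
    simp only [Set.mem_iUnion]
    exact ⟨β.degree, hβ.2, rfl⟩
  refine ⟨∑ β ∈ hfin.toFinset, convMonomial K β • fun i => tailInclusion K n k (slice k β (r i)),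
    N.sum_mem fun β hβ => N.smul_mem _ (h β (hfin.mem_toFinset.mp hβ).1), fun i => ?_⟩
  refine mem_maximalIdeal_pow_of_support fun δ hδ => ?_
  by_contra hlt
  refine hδ ?_
  have hmem : headPart k δ ∈ hfin.toFinset := hfin.mem_toFinset.mpr ⟨headPart_headPart δ, by
    have := degree_eq_add k δ
    omega⟩
  simp only [Finset.sum_apply, Pi.smul_apply, smul_eq_mul, AddSubgroupClass.coe_sub, map_sub,
    AddSubmonoidClass.coe_finsetSum, MulMemClass.coe_mul, map_sum]
  rw [Finset.sum_congr rfl fun β hβ =>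
    coeff_convMonomial_mul_slice (hfin.mem_toFinset.mp hβ).1 (r i) δ]
  rw [Finset.sum_ite_eq, if_pos hmem, sub_self]

end Slice

/-! ### A cylindrical diagram gives flatness -/

section Flatness

variable {K : Type*} [RCLike K] {n k : ℕ}

/-- The equational criterion for flatness of `B/I` over `A`, with relations lifted to `B`. -/
theorem flat_quotientMk_comp_iff {A B : Type*} [CommRing A] [CommRing B] (φ : A →+* B)
    (I : Ideal B) :
    ((Ideal.Quotient.mk I).comp φ).Flat ↔
      ∀ (m : ℕ) (f : Fin m → A) (r : Fin m → B), ∑ i, φ (f i) * r i ∈ I →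
        ∃ (l : ℕ) (s : Fin m → Fin l → A) (c : Fin l → B),
          (∀ i, r i - ∑ j, φ (s i j) * c j ∈ I) ∧ ∀ j, ∑ i, f i * s i j = 0 := by
  let := ((Ideal.Quotient.mk I).comp φ).toAlgebra
  have hsmul : ∀ (a : A) (y : B),
      a • Ideal.Quotient.mk I y = Ideal.Quotient.mk I (φ a * y) :=
    fun a y => (map_mul (Ideal.Quotient.mk I) _ _).symm
  change Module.Flat A (B ⧸ I) ↔ _
  rw [Module.Flat.iff_forall_isTrivialRelation]
  constructor
  · intro h m f r hr
    obtain ⟨l, s, y, hy, hs⟩ := h (l := m) (f := f) (x := fun i => Ideal.Quotient.mk I (r i)) (by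
      simp only [hsmul]
      rw [← map_sum]
      exact Ideal.Quotient.eq_zero_iff_mem.mpr hr)
    choose c hc using fun j => Ideal.Quotient.mk_surjective (y j)
    refine ⟨l, s, c, fun i => ?_, hs⟩
    rw [← Ideal.Quotient.eq, map_sum]
    refine (hy i).trans ?_
    simp only [← hc, hsmul]
  · intro h m f x hx
    choose r hr using fun i => Ideal.Quotient.mk_surjective (x i)
    obtain ⟨l, s, c, hc, hs⟩ := h m f r (by
      rw [← Ideal.Quotient.eq_zero_iff_mem, map_sum, ← hx]
      simp only [← hr, hsmul])
    refine ⟨l, s, fun j => Ideal.Quotient.mk I (c j), fun i => ?_, hs⟩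
    rw [← hr i, Ideal.Quotient.eq.mpr (hc i), map_sum]
    simp only [hsmul]

theorem isFlatOverTail_iff (I : Ideal (convergentSeries K n)) :
    IsFlatOverTail k I ↔
      ∀ (m : ℕ) (f : Fin m → convergentSeries K (n - k)) (r : Fin m → convergentSeries K n),
        ∑ i, tailInclusion K n k (f i) * r i ∈ I →
        ∃ (l : ℕ) (s : Fin m → Fin l → convergentSeries K (n - k))
          (c : Fin l → convergentSeries K n),
          (∀ i, r i - ∑ j, tailInclusion K n k (s i j) * c j ∈ I) ∧
            ∀ j, ∑ i, f i * s i j = 0 :=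
  flat_quotientMk_comp_iff _ I

theorem sum_tailInclusion_mul_eq_zero {lam : Fin n → ℝ} (hlam : ∀ i, 0 < lam i)
    (hk : k ≤ n) {D : Set (Fin k →₀ ℕ)} {I : Ideal (convergentSeries K n)}
    (hI : diagram lam I = cylinder hk D) {m : ℕ} {f : Fin m → convergentSeries K (n - k)}
    {r : Fin m → convergentSeries K n}
    (hr : ∀ i β, coeff β (r i : MvPowerSeries (Fin n) K) ≠ 0 → β ∉ diagram lam I)
    (h : ∑ i, tailInclusion K n k (f i) * r i ∈ I) :
    ∑ i, tailInclusion K n k (f i) * r i = 0 := by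
  classical
  refine eq_zero_of_mem_of_support hlam h fun β hβ hβI => ?_
  rw [AddSubmonoidClass.coe_finsetSum, map_sum] at hβ
  obtain ⟨i, -, hi⟩ := Finset.exists_ne_zero_of_sum_ne_zero hβ
  rw [MulMemClass.coe_mul, coeff_mul] at hi
  obtain ⟨⟨u, v⟩, huv, hne⟩ := Finset.exists_ne_zero_of_sum_ne_zero hi
  obtain rfl := Finset.HasAntidiagonal.mem_antidiagonal.mp huv
  refine hr i v (right_ne_zero_of_mul hne) ?_
  rw [hI, mem_cylinder_iff] at hβI ⊢
  rwa [headPart_add, headPart_eq_zero_of_coeff_tailInclusion (left_ne_zero_of_mul hne),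
    zero_add] at hβI

/-- Given a relation between normal forms modulo `I` with coefficients in `K{x̃}`, the coefficients
of each monomial in the head variables satisfy the same relation, and these coefficient vectors
generate a submodule of `K{x}^m` that contains the normal forms, since it is closed. -/
theorem isFlatOverTail_of_diagram_eq_cylinder {lam : Fin n → ℝ} (hlam : ∀ i, 0 < lam i)
    (hk : k ≤ n) {D : Set (Fin k →₀ ℕ)} {I : Ideal (convergentSeries K n)}
    (hI : diagram lam I = cylinder hk D) : IsFlatOverTail k I := by
  rw [isFlatOverTail_iff]
  intro m f r' hr'
  choose r hrI hr using fun i => exists_normalForm hlam I (r' i)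
  have hsum : ∑ i, tailInclusion K n k (f i) * r i = 0 := by
    refine sum_tailInclusion_mul_eq_zero hlam hk hI hr ?_
    have h1 : ∑ i, tailInclusion K n k (f i) * r i = ∑ i, tailInclusion K n k (f i) * r' i -
        ∑ i, tailInclusion K n k (f i) * (r' i - r i) := by
      rw [← Finset.sum_sub_distrib]
      exact Finset.sum_congr rfl fun i _ => by ring
    rw [h1]
    exact I.sub_mem hr' (I.sum_mem fun i _ => I.mul_mem_left _ (hrI i))
  set V : Set (Fin m → convergentSeries K n) :=
    {v | ∃ s : Fin m → convergentSeries K (n - k), ∑ i, f i * s i = 0 ∧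
      v = fun i => tailInclusion K n k (s i)} with hV
  have hmem : r ∈ Submodule.span (convergentSeries K n) V := by
    refine mem_of_forall_slice_mem (k := k) _ r fun β hβ => Submodule.subset_span
      ⟨fun i => slice k β (r i), ?_, rfl⟩
    simp only [← slice_tailInclusion_mul hβ]
    rw [← map_sum, hsum, map_zero]
  obtain ⟨l, c, v, hv⟩ := Submodule.mem_span_set'.mp hmem
  choose s hs hsv using fun j => (v j).2
  refine ⟨l, fun i j => s j i, c, fun i => ?_, hs⟩
  have h1 : r i = ∑ j, tailInclusion K n k (s j i) * c j := by
    rw [← hv, Finset.sum_apply]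
    refine Finset.sum_congr rfl fun j _ => ?_
    rw [Pi.smul_apply, hsv j, smul_eq_mul, mul_comm]
  rw [← h1]
  exact hrI i

end Flatness

/-! ### Flatness gives cylindrical diagrams -/

section Diagram

variable {K : Type*} [RCLike K] {n k : ℕ}

/-- If `K{x}/I` is flat, then an element of `I` whose terms all have degree at least `p` in the tail
variables is a combination of the monomials of degree `p` in these with coefficients in `I`. -/
theorem exists_eq_sum_of_isFlatOverTail {I : Ideal (convergentSeries K n)}
    (hflat : IsFlatOverTail k I) {G : convergentSeries K n} (hG : G ∈ I) {p : ℕ}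
    (hp : ∀ β, coeff β (G : MvPowerSeries (Fin n) K) ≠ 0 → p ≤ (tailPart k β).degree) :
    ∃ (m : ℕ) (γ : Fin m → Fin (n - k) →₀ ℕ) (H : Fin m → convergentSeries K n),
      (∀ i, (γ i).degree = p) ∧ (∀ i, H i ∈ I) ∧
        G = ∑ i, convMonomial K (tailEmb n k (γ i)) * H i := by
  obtain ⟨m, γ, hγ⟩ : ∃ (m : ℕ) (γ : Fin m → Fin (n - k) →₀ ℕ),
      Set.range γ = {γ | γ.degree = p} := by
    obtain ⟨m, γ, -, hγ⟩ := (finite_degree_eq (n - k) p).fin_param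
    exact ⟨m, γ, hγ⟩
  have hγp : ∀ i, (γ i).degree = p := fun i => by
    have : γ i ∈ {γ : Fin (n - k) →₀ ℕ | γ.degree = p} := hγ ▸ ⟨i, rfl⟩
    exact this
  obtain ⟨Q, hQ⟩ := exists_eq_sum_mul_convMonomial (fun i => tailEmb n k (γ i)) G fun β hβ => by
    obtain ⟨δ, hδ, hdeg⟩ := exists_le_degree_eq (hp β hβ)
    obtain ⟨i, rfl⟩ : δ ∈ Set.range γ := hγ ▸ hdeg
    refine ⟨i, ?_⟩
    obtain ⟨ε, hε⟩ := exists_add_of_le hδ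
    rw [← headPart_add_tailEmb k β, hε, tailEmb_add]
    exact le_add_left le_self_add
  have hrel : ∑ i, tailInclusion K n k (convMonomial K (γ i)) * Q i ∈ I := by
    rw [Finset.sum_congr rfl fun i _ => by rw [tailInclusion_convMonomial, mul_comm], ← hQ]
    exact hG
  obtain ⟨l, s, c, hc, hs⟩ := (isFlatOverTail_iff I).mp hflat m _ Q hrel
  refine ⟨m, γ, fun i => Q i - ∑ j, tailInclusion K n k (s i j) * c j, hγp, hc, ?_⟩
  simp only [← tailInclusion_convMonomial, mul_sub, Finset.sum_sub_distrib, Finset.mul_sum]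
  rw [Finset.sum_comm]
  have h0 : ∀ j, ∑ i, tailInclusion K n k (convMonomial K (γ i)) *
      (tailInclusion K n k (s i j) * c j) = 0 := fun j => by
    simp only [← mul_assoc, ← map_mul]
    rw [← Finset.sum_mul, ← map_sum, hs j, map_zero, zero_mul]
  rw [Finset.sum_eq_zero fun j _ => h0 j, sub_zero, hQ]
  exact Finset.sum_congr rfl fun i _ => by rw [tailInclusion_convMonomial, mul_comm]

/-- The initial exponents of the series `F(y, 0)`, for `F ∈ I`, where the tail variables are set to
`0`, relative to the total degree; they are regarded as exponents of `x` with vanishing tail. -/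
def fiberDiagram (k : ℕ) (I : Ideal (convergentSeries K n)) : Set (Fin n →₀ ℕ) :=
  {α | tailPart k α = 0 ∧ ∃ F ∈ I, coeff α (F : MvPowerSeries (Fin n) K) ≠ 0 ∧
    ∀ β, tailPart k β = 0 → coeff β (F : MvPowerSeries (Fin n) K) ≠ 0 →
      β = α ∨ expLT (fun _ => 1) α β}

theorem headPart_eq_self_iff {β : Fin n →₀ ℕ} : headPart k β = β ↔ tailPart k β = 0 := by
  constructor
  · intro h
    rw [← h, tailPart_headPart]
  · intro h
    conv_rhs => rw [← headPart_add_tailEmb k β, h]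
    simp [tailEmb]

theorem add_mem_fiberDiagram {I : Ideal (convergentSeries K n)} {α δ : Fin n →₀ ℕ}
    (hα : α ∈ fiberDiagram k I) (hδ : tailPart k δ = 0) : δ + α ∈ fiberDiagram k I := by
  obtain ⟨hα0, F, hF, hFα, hmin⟩ := hα
  refine ⟨by rw [tailPart_add, hα0, hδ, add_zero], convMonomial K δ * F, I.mul_mem_left _ hF,
    by simpa [coeff_add_monomial_mul] using hFα, fun β hβ0 hβ => ?_⟩
  rw [MulMemClass.coe_mul, coe_convMonomial, coeff_monomial_mul] at hβ
  split_ifs at hβ with hle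
  · obtain ⟨ε, rfl⟩ := exists_add_of_le hle
    rw [add_tsub_cancel_left, one_mul] at hβ
    rw [tailPart_add, hδ, zero_add] at hβ0
    rcases hmin ε hβ0 hβ with rfl | h
    · exact Or.inl rfl
    · exact Or.inr (h.add_left δ)
  · exact absurd rfl hβ

/-- If `K{x}/I` is flat, no nonzero element of `I` has its support outside the cylinder over the
diagram of the fibre: the terms of lowest degree `p` in the tail variables are monomials of degree
`p` with coefficients `H(y, 0)`, `H ∈ I`. -/
theorem eq_zero_of_support_of_isFlatOverTail {I : Ideal (convergentSeries K n)}
    (hflat : IsFlatOverTail k I) {G : convergentSeries K n} (hG : G ∈ I)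
    (hsupp : ∀ β, coeff β (G : MvPowerSeries (Fin n) K) ≠ 0 → headPart k β ∉ fiberDiagram k I) :
    G = 0 := by
  suffices h : ∀ p β, coeff β (G : MvPowerSeries (Fin n) K) ≠ 0 → p ≤ (tailPart k β).degree by
    apply Subtype.ext
    ext β
    by_contra hβ
    have := h ((tailPart k β).degree + 1) β hβ
    omega
  intro p
  induction p with
  | zero => exact fun _ _ => Nat.zero_le _
  | succ p ih =>
    intro δ hδ
    refine Nat.succ_le_of_lt (lt_of_le_of_ne (ih δ hδ) fun hdeg => ?_)
    obtain ⟨m, γ, H, hγ, hH, hGH⟩ := exists_eq_sum_of_isFlatOverTail hflat hG ih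
    -- The part of `G` in `x̃ ^ δ''`, for `δ''` the tail of `δ`, is `∑ H i (y, 0)` over the `i` with
    -- `γ i = δ''`.
    classical
    set E : convergentSeries K n := ∑ i ∈ Finset.univ.filter (γ · = tailPart k δ), H i with hE
    have hEI : E ∈ I := I.sum_mem fun i _ => hH i
    have hcoeff : ∀ α, tailPart k α = 0 → coeff α (E : MvPowerSeries (Fin n) K) =
        coeff (α + tailEmb n k (tailPart k δ)) (G : MvPowerSeries (Fin n) K) := by
      intro α hα
      rw [hE, hGH]
      simp only [AddSubmonoidClass.coe_finsetSum, map_sum, MulMemClass.coe_mul, coe_convMonomial]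
      rw [Finset.sum_filter]
      refine Finset.sum_congr rfl fun i _ => ?_
      split_ifs with hi
      · rw [hi, add_comm, coeff_add_monomial_mul, one_mul]
      · rw [coeff_monomial_mul, if_neg]
        intro hle
        obtain ⟨ε, hε⟩ := exists_add_of_le hle
        have h1 := congrArg (tailPart k) hε
        rw [tailPart_add, tailPart_add, hα, tailPart_tailEmb, tailPart_tailEmb, zero_add] at h1
        have h2 := congrArg Finsupp.degree h1
        rw [map_add, hγ i, ← hdeg] at h2
        have h3 : tailPart k ε = 0 := by
          rw [← Finsupp.degree_eq_zero_iff]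
          omega
        rw [h3, add_zero] at h1
        exact hi h1.symm
    obtain ⟨α, ⟨hα0, hα⟩, hmin⟩ := exists_expLT_least (lam := fun _ => (1 : ℝ))
      (fun _ => one_pos)
      (S := {α | tailPart k α = 0 ∧ coeff α (E : MvPowerSeries (Fin n) K) ≠ 0})
      ⟨headPart k δ, tailPart_headPart δ, by
        rwa [hcoeff _ (tailPart_headPart δ), headPart_add_tailEmb]⟩
    have hmem : α ∈ fiberDiagram k I :=
      ⟨hα0, E, hEI, hα, fun β hβ0 hβ => hmin β ⟨hβ0, hβ⟩⟩
    rw [hcoeff α hα0] at hα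
    refine hsupp _ hα ?_
    rwa [headPart_add, headPart_tailEmb, add_zero, headPart_eq_self_iff.mpr hα0]

/-- The coefficients of the linear form with weight `1` on the head and `l` on the tail. -/
theorem linForm_headTail (l : ℝ) (β : Fin n →₀ ℕ) :
    linForm (fun i : Fin n => if (i : ℕ) < k then 1 else l) β =
      linForm (fun _ => 1) (headPart k β) + l * (tailPart k β).degree := by
  set lam : Fin n → ℝ := fun i : Fin n => if (i : ℕ) < k then 1 else l with hlam
  conv_lhs => rw [← headPart_add_tailEmb k β, linForm_add]
  congr 1
  · refine Finset.sum_congr rfl fun i _ => ?_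
    by_cases hi : (i : ℕ) < k
    · simp [hlam, hi]
    · rw [headPart_apply_of_not_lt _ hi]
      simp
  · rw [← degree_tailEmb, cast_degree, Finset.mul_sum]
    refine Finset.sum_congr rfl fun i _ => ?_
    by_cases hi : (i : ℕ) < k
    · rw [tailEmb_apply_of_lt _ hi]
      simp
    · simp [hlam, hi]

theorem exists_diagram_eq_cylinder_of_isFlatOverTail (hk : k ≤ n)
    {I : Ideal (convergentSeries K n)} (hflat : IsFlatOverTail k I) :
    ∃ (l₀ : ℕ) (D : Set (Fin k →₀ ℕ)), 1 ≤ l₀ ∧ ∀ l : ℝ, (l₀ : ℝ) ≤ l →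
      diagram (fun i : Fin n => if (i : ℕ) < k then 1 else l) I = cylinder hk D := by
  obtain ⟨T, hTS, hT, hcover⟩ := exists_finite_generators (S := fiberDiagram k I)
  obtain ⟨D, hD⟩ := exists_eq_cylinder hk (fiberDiagram k I)
  obtain ⟨d, hd⟩ := (hT.image Finsupp.degree).bddAbove
  have hfib : ∀ i : hT.toFinset, (i : Fin n →₀ ℕ) ∈ fiberDiagram k I := fun i =>
    hTS (hT.mem_toFinset.mp i.2)
  choose hT0 F hFI hF hFmin using hfib
  refine ⟨d + 1, D, by omega, fun l hl => ?_⟩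
  set lam : Fin n → ℝ := fun i : Fin n => if (i : ℕ) < k then 1 else l with hlam
  have hlpos : 0 < l := lt_of_lt_of_le (by positivity) hl
  have hlam0 : ∀ i, 0 < lam i := fun i => by
    simp only [hlam]
    split_ifs
    · exact one_pos
    · exact hlpos
  have hone : ∀ β : Fin n →₀ ℕ, linForm (fun _ => 1) β = β.degree := fun β => by
    rw [cast_degree, linForm]
    simp
  have hFinit : ∀ i, IsInitialExponent lam (F i : MvPowerSeries (Fin n) K) i := by
    refine fun i => ⟨hF i, fun β hβ => ?_⟩
    have hi : linForm lam (i : Fin n →₀ ℕ) = (i : Fin n →₀ ℕ).degree := by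
      rw [linForm_headTail, hT0 i, headPart_eq_self_iff.mpr (hT0 i), hone]
      simp
    by_cases hβ0 : tailPart k β = 0
    · refine (hFmin i β hβ0 hβ).imp_right fun h => ?_
      have hβ1 : linForm lam β = β.degree := by
        rw [linForm_headTail, hβ0, headPart_eq_self_iff.mpr hβ0, hone]
        simp
      simpa only [expLT, hone, hi, hβ1] using h
    · -- A monomial that involves the tail has weight at least `l`, more than the degree of `i`.
      refine Or.inr (Or.inl ?_)
      have h1 : (i : Fin n →₀ ℕ).degree ≤ d := hd ⟨_, hT.mem_toFinset.mp i.2, rfl⟩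
      have h2 : 1 ≤ (tailPart k β).degree := Nat.one_le_iff_ne_zero.mpr fun h =>
        hβ0 ((Finsupp.degree_eq_zero_iff _).mp h)
      have h3 : ((i : Fin n →₀ ℕ).degree : ℝ) ≤ d := by exact_mod_cast h1
      have h4 : (1 : ℝ) ≤ (tailPart k β).degree := by exact_mod_cast h2
      rw [hi, linForm_headTail, hone]
      have h5 : (0 : ℝ) ≤ (headPart k β).degree := Nat.cast_nonneg _
      push_cast at hl
      nlinarith
  have hcyl : ∀ β : Fin n →₀ ℕ, headPart k β ∈ fiberDiagram k I ↔
      ∃ i : hT.toFinset, (i : Fin n →₀ ℕ) ≤ β := by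
    refine fun β => ⟨fun h => ?_, fun ⟨i, hi⟩ => ?_⟩
    · obtain ⟨α, hα, hle⟩ := hcover _ h
      exact ⟨⟨α, hT.mem_toFinset.mpr hα⟩, hle.trans (headPart_le β)⟩
    · obtain ⟨δ, rfl⟩ := exists_add_of_le hi
      rw [headPart_add, headPart_eq_self_iff.mpr (hT0 i), add_comm]
      exact add_mem_fiberDiagram (hTS (hT.mem_toFinset.mp i.2)) (tailPart_headPart δ)
  rw [hD]
  ext β
  rw [Set.mem_ofPred_eq]
  constructor
  · rintro ⟨G, hG, -, hβ⟩
    by_contra hcon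
    obtain ⟨Q, R, hGR, hR, hRβ⟩ := exists_division hlam0 F _ hFinit G
    have hRI : R ∈ I := by
      rw [show R = G - ∑ i, Q i * F i by rw [hGR, add_sub_cancel_left]]
      exact I.sub_mem hG (I.sum_mem fun i _ => I.mul_mem_left _ (hFI i))
    have hR0 : R = 0 := eq_zero_of_support_of_isFlatOverTail hflat hRI fun γ hγ hγI => by
      obtain ⟨i, hi⟩ := (hcyl γ).mp hγI
      exact hR γ hγ i hi
    refine hRβ β hβ (fun i hi => hcon ((hcyl β).mpr ⟨i, hi⟩)) ?_
    rw [hR0]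
    simp
  · intro hβ
    obtain ⟨i, hi⟩ := (hcyl β).mp hβ
    obtain ⟨δ, rfl⟩ := exists_add_of_le hi
    have hinit := (hFinit i).monomial_mul δ
    rw [add_comm]
    refine ⟨convMonomial K δ * F i, I.mul_mem_left _ (hFI i), fun h0 => hinit.1 ?_, hinit⟩
    rw [← coe_convMonomial, ← MulMemClass.coe_mul, h0]
    simp

end Diagram

end FlatDiagram

theorem proposition2p5 {K : Type*} [RCLike K] (n k : ℕ) (hk : 1 ≤ k) (hkn : k < n)
    (I : Ideal (FlatDiagram.convergentSeries K n)) :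
    ((∃ (lam : Fin n → ℝ) (D : Set (Fin k →₀ ℕ)), (∀ i, 0 < lam i) ∧
        FlatDiagram.diagram lam I = FlatDiagram.cylinder hkn.le D) →
      FlatDiagram.IsFlatOverTail k I) ∧
    (FlatDiagram.IsFlatOverTail k I →
      ∃ (l₀ : ℕ) (D : Set (Fin k →₀ ℕ)), 1 ≤ l₀ ∧ ∀ l : ℝ, (l₀ : ℝ) ≤ l →
        FlatDiagram.diagram (fun i : Fin n => if (i : ℕ) < k then 1 else l) I =
          FlatDiagram.cylinder hkn.le D) := by
  refine ⟨?_, fun h => FlatDiagram.exists_diagram_eq_cylinder_of_isFlatOverTail hkn.le h⟩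
  rintro ⟨lam, D, hlam, hI⟩
  exact FlatDiagram.isFlatOverTail_of_diagram_eq_cylinder hlam hkn.le hI
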